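/- All graphs are finite and simple. A graph $G$ is a *path graph* if there are a tree $T$ and a bijection $\phi$ from $V(G)$ onto a collection of paths of $T$ (one-vertex paths allowed) such that two distinct vertices $u,v$ of $G$ are adjacent if and only if the vertex sets of $\phi(u)$ and $\phi(v)$ intersect. $G$ is *chordal* if it has no induced cycle of length at least four. "Clique" means inclusion-wise maximal clique. A *clique separator* of $G$ is a clique $Q$ such that $G-Q$ has at least two connected components. Let $V_1,\dots,V_s$ be the vertex sets of these components, $\gamma_i=G[V_i\cup Q]$ and $\Gamma_Q=\{\gamma_1,\dots,\gamma_s\}$. A *relevant clique* of $\gamma\in\Gamma_Q$ is a clique $K$ of the graph $\gamma$ with $K\cap Q\neq\emptyset$ and $K\neq Q$; $\gamma$ is a *neighboring subgraph* of a vertex $v$ if $v$ lies in some relevant clique of $\gamma$. For $\gamma,\gamma'\in\Gamma_Q$: - $\gamma\Join\gamma'$ (*attached*) if $K\cap K'\cap Q\neq\emptyset$ for some relevant cliques $K$ of $\gamma$ and $K'$ of $\gamma'$; - $\gamma\le\gamma'$ (*dominance*) if $\gamma=\gamma'$, or $\gamma\Join\gamma'$ and for each relevant clique $K'$ of $\gamma'$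 either $K\cap Q\subseteq K'\cap Q$ for every relevant clique $K$ of $\gamma$, or $K\cap K'\cap Q=\emptyset$ for every relevant clique $K$ of $\gamma$; - $\gamma\leftrightarrow\gamma'$ (*antipodal*) if $\gamma\Join\gamma'$, $\gamma\not\le\gamma'$ and $\gamma'\not\le\gamma$. Dominance is a preorder. From now on $\Gamma_Q$ stands for its quotient in which $\gamma$ and $\gamma'$ are identified if $\gamma\le\gamma'$ and $\gamma'\le\gamma$; it is partially ordered by $\le$, and a class is attached to another class, or is a neighboring subgraph of $v$, if this holds for some representatives; two classes are antipodal if they are attached and $\le$-incomparable. A *full antipodal triple* consists of three pairwise antipodal elements of $\Gamma_Q$ that are neighboring subgraphs of a common vertex $v\in Q$. Let $\mathrm{Upper}_Q$ be the set of $u\in\Gamma_Q$ with $u\not\le\gamma$ for all $\gamma\neq u$, let $\ell=|\mathrm{Upper}_Q|$, and fix for each $Q$ an arbitrary ordering $(u_1,\dots,u_\ell)$ of $\mathrm{Upper}_Q$. For $i<j$ in $[\ell]=\{1,\dots,\ell\}$ let $$D_i=\{\gamma\in\Gamma_Q : \gamma\le u_i,\ \gamma\not\le u_k\ \forall k\ne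 i\},\qquad D_{i,j}=\{\gamma\in\Gamma_Q : \gamma\le u_i,\ \gamma\le u_j,\ \gamma\not\le u_k\ \forall k\ne i,j\},$$ and let the *$Q$-skeleton* be $\mathcal D=\{D_i : i\in[\ell]\}\cup\{D_{i,j} : i<j\in[\ell]\}$. **Theorem.** A chordal graph $G$ is a path graph if and only if, for every clique separator $Q$ of $G$, $\mathrm{Upper}_Q$ contains no full antipodal triple and $G$ is weak $Q$-colorable, that is, there exists $f:\Gamma_Q\to[\ell+1]$ such that: - (a) for all $i\in[\ell]$, $f(u_i)=i$; - (b) for all $i\in[\ell]$ and $\gamma\in D_i$, $f(\gamma)\in\{i,\ell+1\}$; - (c) for all $i<j\in[\ell]$ and $\gamma\in D_{i,j}$, $f(\gamma)\in\{i,j\}$; - (d) for all $i\in[\ell]$ and $\gamma\in D_i$, if $\gamma\leftrightarrow u$ for some $u\in\mathrm{Upper}_Q$, then $f(\gamma)=i$; - (e) for all $i<j\in[\ell]$, $k\in\{i,j\}$ and $\gamma\in D_{i,j}$, if $\gamma\leftrightarrow\gamma'$ for some $\gamma'\in D_k$, then $f(\gamma)$ is the element of $\{i,j\}\setminus\{k\}$;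 - (f) for all $D\in\mathcal D$ and $\gamma,\gamma'\in D$ with $\gamma\leftrightarrow\gamma'$, $f(\gamma)\ne f(\gamma')$. -/

import Mathlib

universe u

namespace PathGraph

variable {V : Type u}

/-- `s` is the vertex set of a path of the graph `T` (one-vertex paths are allowed). -/
def IsPathVertexSet {W : Type u} (T : SimpleGraph W) (s : Set W) : Prop :=
  ∃ (a b : W) (p : T.Walk a b), p.IsPath ∧ s = {w | w ∈ p.support}

/-- `G` is a path graph: there are a finite host tree `T` and a bijection from the vertices of `G`
onto a collection of paths of `T` such that two distinct vertices are adjacent if and only if the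
vertex sets of their paths intersect. A path of a tree is identified with its vertex set. -/
def IsPathGraph (G : SimpleGraph V) : Prop :=
  ∃ (W : Type u) (_ : Finite W) (T : SimpleGraph W) (φ : V → Set W),
    T.IsTree ∧ (∀ v, IsPathVertexSet T (φ v)) ∧ Function.Injective φ ∧
      ∀ v w, v ≠ w → (G.Adj v w ↔ (φ v ∩ φ w).Nonempty)

/-- `G` is chordal: it has no induced cycle of length at least four. -/
def IsChordal (G : SimpleGraph V) : Prop :=
  ∀ n : ℕ, 4 ≤ n → ¬ (SimpleGraph.cycleGraph n).IsIndContained G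

/-- A clique separator: a maximal clique whose removal leaves more than one connected component. -/
def IsCliqueSeparator (G : SimpleGraph V) (Q : Set V) : Prop :=
  Maximal G.IsClique Q ∧ Nontrivial (G.ComponentCompl Q)

/-- The members of `Γ_Q`: there is one for every connected component of `G - Q`, namely the
subgraph induced by the component together with `Q`. (This is a separate type because
`G.ComponentCompl Q` already carries the inclusion order.) -/
@[ext]
structure SepPart (G : SimpleGraph V) (Q : Set V) where
  comp : G.ComponentCompl Q

variable {G : SimpleGraph V} {Q : Set V}

/-- The vertex set `V_i ∪ Q` of `γ_i = G[V_i ∪ Q]`. -/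
def SepPart.verts (γ : SepPart G Q) : Set V := γ.comp.supp ∪ Q

/-- `K` is a relevant clique of `γ`: a maximal clique of `γ` with `K ∩ Q ≠ ∅` and `K ≠ Q`. -/
def SepPart.Relevant (γ : SepPart G Q) (K : Set V) : Prop :=
  Maximal (fun S : Set V => S ⊆ γ.verts ∧ G.IsClique S) K ∧ (K ∩ Q).Nonempty ∧ K ≠ Q

/-- `γ` is a neighboring subgraph of the vertex `v`. -/
def SepPart.NeighborOf (γ : SepPart G Q) (v : V) : Prop :=
  ∃ K, γ.Relevant K ∧ v ∈ K

/-- Attachedness. -/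
def SepPart.Attached (γ γ' : SepPart G Q) : Prop :=
  ∃ K K', γ.Relevant K ∧ γ'.Relevant K' ∧ (K ∩ K' ∩ Q).Nonempty

/-- The defining condition of dominance of `γ` by a different member `γ'`. -/
def SepPart.DominatedBy (γ γ' : SepPart G Q) : Prop :=
  γ.Attached γ' ∧ ∀ K', γ'.Relevant K' →
    (∀ K, γ.Relevant K → K ∩ Q ⊆ K' ∩ Q) ∨ (∀ K, γ.Relevant K → K ∩ K' ∩ Q = ∅)

/-- Dominance, a preorder on `Γ_Q`; it is reflexive by convention. -/
instance : Preorder (SepPart G Q) where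
  le γ γ' := γ = γ' ∨ γ.DominatedBy γ'
  le_refl _ := Or.inl rfl
  le_trans := by
    rintro a b c (rfl | hab) (rfl | hbc)
    · exact Or.inl rfl
    · exact Or.inr hbc
    · exact Or.inr hab
    · right
      obtain ⟨⟨A, B, hA, hB, v, hv⟩, hab'⟩ := hab
      obtain ⟨⟨B', C, hB', hC, w, hw⟩, hbc'⟩ := hbc
      have hAB : ∀ K, a.Relevant K → K ∩ Q ⊆ B ∩ Q := by
        rcases hab' B hB with h | h
        · exact h
        · exact absurd ⟨v, hv⟩ (Set.not_nonempty_iff_eq_empty.mpr (h A hA))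
      have hBC : ∀ K, b.Relevant K → K ∩ Q ⊆ C ∩ Q := by
        rcases hbc' C hC with h | h
        · exact h
        · exact absurd ⟨w, hw⟩ (Set.not_nonempty_iff_eq_empty.mpr (h B' hB'))
      refine ⟨⟨A, C, hA, hC, v, ⟨hv.1.1, (hBC B hB ⟨hv.1.2, hv.2⟩).1⟩, hv.2⟩, fun K' hK' => ?_⟩
      rcases hbc' K' hK' with h | h
      · exact Or.inl fun K hK => (hAB K hK).trans (h B hB)
      · refine Or.inr fun K hK => Set.eq_empty_iff_forall_notMem.mpr fun x hx => ?_
        have hxB := (hAB K hK ⟨hx.1.1, hx.2⟩).1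
        exact (Set.eq_empty_iff_forall_notMem.mp (h B hB)) x ⟨⟨hxB, hx.1.2⟩, hx.2⟩

/-- `Γ_Q` with mutually dominating members identified, partially ordered by dominance. -/
abbrev Gam (G : SimpleGraph V) (Q : Set V) : Type u :=
  Antisymmetrization (SepPart G Q) (· ≤ ·)

/-- The class in `Gam G Q` of a member of `Γ_Q`. -/
abbrev SepPart.cls (γ : SepPart G Q) : Gam G Q := toAntisymmetrization (· ≤ ·) γ

/-- A class is a neighboring subgraph of `v` if one of its representatives is. -/
def Gam.NeighborOf (c : Gam G Q) (v : V) : Prop :=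
  ∃ γ : SepPart G Q, γ.cls = c ∧ γ.NeighborOf v

/-- Attachedness of classes. -/
def Gam.Attached (c c' : Gam G Q) : Prop :=
  ∃ γ γ' : SepPart G Q, γ.cls = c ∧ γ'.cls = c' ∧ γ.Attached γ'

/-- Antipodality: attached, and neither one dominates the other. -/
def Gam.Antipodal (c c' : Gam G Q) : Prop :=
  c.Attached c' ∧ ¬ c ≤ c' ∧ ¬ c' ≤ c

/-- `Upper_Q`: the elements that are dominated by no other element. -/
def Upper (G : SimpleGraph V) (Q : Set V) : Set (Gam G Q) :=
  {u | ∀ c, c ≠ u → ¬ u ≤ c}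

/-- A full antipodal triple: three pairwise antipodal elements which are neighboring subgraphs of
a common vertex of `Q`. -/
def IsFullAntipodalTriple (a b c : Gam G Q) : Prop :=
  a.Antipodal b ∧ a.Antipodal c ∧ b.Antipodal c ∧
    ∃ v ∈ Q, a.NeighborOf v ∧ b.NeighborOf v ∧ c.NeighborOf v

/-- The number `ℓ = |Upper_Q|`. -/
noncomputable def ell (G : SimpleGraph V) (Q : Set V) : ℕ := Nat.card (Upper G Q)

/-- An ordering `(u_1, ..., u_ℓ)` of `Upper_Q`. -/
abbrev UpperOrdering (G : SimpleGraph V) (Q : Set V) : Type u := Fin (ell G Q) ≃ Upper G Q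

/-- `D_i`: the elements dominated by `u_i` and by no other element of `Upper_Q`. -/
def D₁ (o : UpperOrdering G Q) (i : Fin (ell G Q)) : Set (Gam G Q) :=
  {c | c ≤ (o i : Gam G Q) ∧ ∀ k, k ≠ i → ¬ c ≤ (o k : Gam G Q)}

/-- `D_{i,j}`: the elements dominated by `u_i` and `u_j` and by no other element of `Upper_Q`. -/
def D₂ (o : UpperOrdering G Q) (i j : Fin (ell G Q)) : Set (Gam G Q) :=
  {c | c ≤ (o i : Gam G Q) ∧ c ≤ (o j : Gam G Q) ∧
    ∀ k, k ≠ i → k ≠ j → ¬ c ≤ (o k : Gam G Q)}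

/-- The `Q`-skeleton. -/
def skeleton (o : UpperOrdering G Q) : Set (Set (Gam G Q)) :=
  {D | (∃ i, D = D₁ o i) ∨ ∃ i j, i < j ∧ D = D₂ o i j}

/-- `f` is a weak `Q`-coloring. The color set `[ℓ+1]` is `Fin (ℓ+1)`: the color `i ∈ [ℓ]` is
`i.castSucc`, and the color `ℓ+1` is `Fin.last ℓ`. -/
structure IsWeakColoring (o : UpperOrdering G Q) (f : Gam G Q → Fin (ell G Q + 1)) : Prop where
  upper : ∀ i, f (o i : Gam G Q) = i.castSucc
  single : ∀ i, ∀ c ∈ D₁ o i, f c = i.castSucc ∨ f c = Fin.last (ell G Q)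
  double : ∀ i j, i < j → ∀ c ∈ D₂ o i j, f c = i.castSucc ∨ f c = j.castSucc
  single_antipodal : ∀ i, ∀ c ∈ D₁ o i, (∃ u ∈ Upper G Q, c.Antipodal u) → f c = i.castSucc
  double_antipodal : ∀ i j, i < j → ∀ c ∈ D₂ o i j,
    ((∃ c' ∈ D₁ o i, c.Antipodal c') → f c = j.castSucc) ∧
    ((∃ c' ∈ D₁ o j, c.Antipodal c') → f c = i.castSucc)
  proper : ∀ D ∈ skeleton o, ∀ c ∈ D, ∀ c' ∈ D, c.Antipodal c' → f c ≠ f c'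

end PathGraph

/-! Both directions pass through an intermediate notion, `StrongColorable`: attached parts of equal
color are comparable, and a vertex of `Q` sees parts of at most two colors.

Weak and strong colorings are equivalent once full antipodal triples of upper elements are excluded.
Dominance enlarges the set of vertices of `Q` that a part sees, and two upper elements seeing a
common vertex are antipodal. Hence a vertex of `Q` sees at most two upper elements. If it sees two,
their colors are the only ones at the vertex; if it sees one, `u_i`, the only colors are `i` and
`ℓ+1`. This gives `color_ne_of_antipodal` and `strongColorable_of_weak`. Conversely,
`exists_weakColoring_of_strong` renames strong colors after the upper elements above a class.

In a path graph, the paths of the vertices of `Q` share a node `q` by the Helly property. The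
vertices of each component of `G - Q` occupy a subtree missing `q`; coloring a part by the branch at
`q` that holds this subtree is strong (`IsPathGraph.strongColorable`).

For the converse, a clique tree is built whose nodes are maximal cliques and in which the bags
containing a given vertex form a path. Around a central clique `Q`, the trees of the parts are hung
on one at a time, dominated parts after dominating ones. In each color, the bags at a vertex of `Q`
then grow a single arm from the center, and two colors give a path (`GluedTree.exists_of_pieces`).
The tree of one part comes from the same construction around a smaller clique inside the part, by
induction on the size of the component (`exists_pieceTree`); chordality supplies that clique
(`IsChordal.exists_adj_all`). -/

namespace PathGraph

/-! ### Weak colorings versus strong colorings. -/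

section Coloring

variable {V : Type u} {G : SimpleGraph V} {Q : Set V}

/-- A strong coloring of the parts: attached parts of the same color are comparable, and every
vertex of `Q` sees at most two colors. -/
def StrongColorable (G : SimpleGraph V) (Q : Set V) : Prop :=
  ∃ (α : Type u) (f : SepPart G Q → α),
    (∀ a b, a.Attached b → f a = f b → a ≤ b ∨ b ≤ a) ∧
    ∀ v ∈ Q, ∀ a b c : SepPart G Q, a.NeighborOf v → b.NeighborOf v → c.NeighborOf v →
      f a = f b ∨ f a = f c ∨ f b = f c

theorem SepPart.attached_iff {a b : SepPart G Q} :
    a.Attached b ↔ ∃ v ∈ Q, a.NeighborOf v ∧ b.NeighborOf v := by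
  constructor
  · rintro ⟨K, K', hK, hK', v, ⟨hv, hv'⟩, hvQ⟩
    exact ⟨v, hvQ, ⟨K, hK, hv⟩, K', hK', hv'⟩
  · rintro ⟨v, hvQ, ⟨K, hK, hv⟩, K', hK', hv'⟩
    exact ⟨K, K', hK, hK', v, ⟨hv, hv'⟩, hvQ⟩

/-- Attachedness provides a relevant clique of `b` that meets one of `a`, so for this clique the
containment alternative of dominance must hold. -/
theorem SepPart.NeighborOf.mono {a b : SepPart G Q} (hab : a ≤ b) {v : V} (hv : v ∈ Q)
    (ha : a.NeighborOf v) : b.NeighborOf v := by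
  rcases hab with rfl | ⟨⟨K, K', hK, hK', w, hw⟩, h⟩
  · exact ha
  · obtain ⟨L, hL, hvL⟩ := ha
    rcases h K' hK' with h | h
    · exact ⟨K', hK', (h L hL ⟨hvL, hv⟩).1⟩
    · exact absurd ⟨w, hw⟩ (Set.not_nonempty_iff_eq_empty.mpr (h K hK))

theorem SepPart.exists_neighborOf {a b : SepPart G Q} (hab : a ≤ b) (hne : a ≠ b) :
    ∃ v ∈ Q, a.NeighborOf v := by
  rcases hab with rfl | ⟨h, -⟩
  · exact absurd rfl hne
  · obtain ⟨v, hv, h, -⟩ := SepPart.attached_iff.mp h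
    exact ⟨v, hv, h⟩

theorem SepPart.cls_le_cls {a b : SepPart G Q} : a.cls ≤ b.cls ↔ a ≤ b :=
  toAntisymmetrization_le_toAntisymmetrization_iff

theorem SepPart.neighborOf_cls {a : SepPart G Q} {v : V} (hv : v ∈ Q) :
    a.cls.NeighborOf v ↔ a.NeighborOf v := by
  constructor
  · rintro ⟨b, hb, h⟩
    exact h.mono (SepPart.cls_le_cls.mp hb.le) hv
  · exact fun h => ⟨a, rfl, h⟩

namespace Gam

theorem attached_iff {c c' : Gam G Q} :
    c.Attached c' ↔ ∃ v ∈ Q, c.NeighborOf v ∧ c'.NeighborOf v := by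
  constructor
  · rintro ⟨a, b, rfl, rfl, h⟩
    obtain ⟨v, hv, h, h'⟩ := SepPart.attached_iff.mp h
    exact ⟨v, hv, ⟨a, rfl, h⟩, b, rfl, h'⟩
  · rintro ⟨v, hv, ⟨a, rfl, ha⟩, b, rfl, hb⟩
    exact ⟨a, b, rfl, rfl, SepPart.attached_iff.mpr ⟨v, hv, ha, hb⟩⟩

theorem NeighborOf.mono {c c' : Gam G Q} (hc : c ≤ c') {v : V} (hv : v ∈ Q)
    (h : c.NeighborOf v) : c'.NeighborOf v := by
  induction c' using Antisymmetrization.ind with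
  | _ b =>
    obtain ⟨a, rfl, ha⟩ := h
    exact ⟨b, rfl, ha.mono (SepPart.cls_le_cls.mp hc) hv⟩

/-- Strict dominance includes attachedness. This supplies the vertex of `Q` at which colors are
compared below. -/
theorem exists_neighborOf {c c' : Gam G Q} (hc : c ≤ c') (hne : c ≠ c') :
    ∃ v ∈ Q, c.NeighborOf v := by
  induction c using Antisymmetrization.ind with
  | _ a =>
    induction c' using Antisymmetrization.ind with
    | _ b =>
      obtain ⟨v, hv, h⟩ := SepPart.exists_neighborOf (SepPart.cls_le_cls.mp hc)
        (fun h => hne (h ▸ rfl))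
      exact ⟨v, hv, a, rfl, h⟩

theorem Antipodal.symm {c c' : Gam G Q} (h : c.Antipodal c') : c'.Antipodal c := by
  obtain ⟨h, h1, h2⟩ := h
  obtain ⟨v, hv, h, h'⟩ := attached_iff.mp h
  exact ⟨attached_iff.mpr ⟨v, hv, h', h⟩, h2, h1⟩

theorem eq_of_upper_le {u c : Gam G Q} (hu : u ∈ Upper G Q) (h : u ≤ c) : c = u := by
  by_contra hne
  exact hu c hne h

/-- An element that is not dominated by an upper element is antipodal to it as soon as they share
a neighbor. -/
theorem antipodal_of_not_le_upper {c u : Gam G Q} (hu : u ∈ Upper G Q) (hcu : ¬ c ≤ u) {v : V}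
    (hv : v ∈ Q) (hc : c.NeighborOf v) (hu' : u.NeighborOf v) : c.Antipodal u :=
  ⟨attached_iff.mpr ⟨v, hv, hc, hu'⟩, hcu, fun h => hcu (eq_of_upper_le hu h).le⟩

instance [Finite V] : Finite (G.ComponentCompl Q) :=
  inferInstanceAs (Finite (Quot _))

instance [Finite V] : Finite (SepPart G Q) :=
  Finite.of_injective SepPart.comp fun _ _ h => SepPart.ext h

instance [Finite V] : Finite (Gam G Q) :=
  inferInstanceAs (Finite (Quotient _))

theorem exists_le_upper [Finite V] (o : UpperOrdering G Q) (c : Gam G Q) :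
    ∃ i, c ≤ (o i : Gam G Q) := by
  obtain ⟨u, hcu, hu⟩ := Set.toFinite (Set.univ : Set (Gam G Q)) |>.exists_le_maximal
    (Set.mem_univ c)
  have hu' : u ∈ Upper G Q := fun d hd hud =>
    hd (le_antisymm (hu.2 (Set.mem_univ d) hud) hud)
  refine ⟨o.symm ⟨u, hu'⟩, ?_⟩
  simpa using hcu

theorem upper_not_le {o : UpperOrdering G Q} {i j : Fin (ell G Q)} (hij : i ≠ j) :
    ¬ (o i : Gam G Q) ≤ o j := fun h =>
  hij (o.injective (Subtype.ext (eq_of_upper_le (o i).2 h).symm))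

theorem upper_antipodal {o : UpperOrdering G Q} {i j : Fin (ell G Q)} (hij : i ≠ j) {v : V}
    (hv : v ∈ Q) (hi : Gam.NeighborOf (o i : Gam G Q) v)
    (hj : Gam.NeighborOf (o j : Gam G Q) v) :
    Gam.Antipodal (o i : Gam G Q) (o j) :=
  antipodal_of_not_le_upper (o j).2 (upper_not_le hij) hv hi hj

end Gam

open Gam

/-! ### From a strong to a weak coloring. -/

section StrongToWeak

variable {α : Type u} {f : Gam G Q → α}
  (hf : ∀ c c' : Gam G Q, c.Antipodal c' → f c ≠ f c')
  (hf2 : ∀ v ∈ Q, ∀ a b c : Gam G Q, a.NeighborOf v → b.NeighborOf v → c.NeighborOf v →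
    f a = f b ∨ f a = f c ∨ f b = f c)

include hf hf2

theorem no_triple_of_strong (a b c : Gam G Q) : ¬ IsFullAntipodalTriple a b c := by
  rintro ⟨hab, hac, hbc, v, hv, ha, hb, hc⟩
  rcases hf2 v hv a b c ha hb hc with h | h | h
  · exact hf _ _ hab h
  · exact hf _ _ hac h
  · exact hf _ _ hbc h

/-- At a vertex seen by `c` and `w`, also `u` is seen and is antipodal to `w`. Both `c` and `u`
differ in color from `w`, and only two colors are available. -/
theorem color_eq_of_antipodal_upper {c u w : Gam G Q} (hw : w ∈ Upper G Q)
    (hcu : c ≤ u) (hcw : c.Antipodal w) : f c = f u := by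
  obtain ⟨v, hv, hc, hw'⟩ := attached_iff.mp hcw.1
  have huv := hc.mono hcu hv
  have huw : u.Antipodal w := by
    refine antipodal_of_not_le_upper hw (fun h => hcw.2.1 (hcu.trans h)) hv huv hw'
  rcases hf2 v hv c u w hc huv hw' with h | h | h
  · exact h
  · exact absurd h (hf _ _ hcw)
  · exact absurd h (hf _ _ huw)

theorem color_mem_of_mem_D₂ {o : UpperOrdering G Q} {i j : Fin (ell G Q)} (hij : i < j)
    {c : Gam G Q} (hc : c ∈ D₂ o i j) : f c = f (o i) ∨ f c = f (o j) := by
  have hne : c ≠ o i := by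
    rintro rfl
    exact upper_not_le hij.ne hc.2.1
  obtain ⟨v, hv, h⟩ := exists_neighborOf hc.1 hne
  have hi := h.mono hc.1 hv
  have hj := h.mono hc.2.1 hv
  rcases hf2 v hv c (o i) (o j) h hi hj with h | h | h
  · exact Or.inl h
  · exact Or.inr h
  · exact absurd h (hf _ _ (upper_antipodal hij.ne hv hi hj))

-- A class takes the index of an upper element above it with the same strong color, and `ℓ+1` if
-- there is none. The index is unique: two upper elements above a common class see a common vertex,
-- so they are antipodal and differ in strong color.
open Classical in
theorem exists_weakColoring_of_strong (o : UpperOrdering G Q) :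
    ∃ g, IsWeakColoring o g := by
  let g : Gam G Q → Fin (ell G Q + 1) := fun c =>
    if h : ∃ i, c ≤ (o i : Gam G Q) ∧ f c = f (o i) then h.choose.castSucc else Fin.last _
  have g_eq : ∀ c i, c ≤ (o i : Gam G Q) → f c = f (o i) → g c = i.castSucc := by
    intro c i hci hfi
    have h : ∃ i, c ≤ (o i : Gam G Q) ∧ f c = f (o i) := ⟨i, hci, hfi⟩
    have hg : g c = h.choose.castSucc := dif_pos h
    rw [hg]
    by_contra hne
    have hne' : h.choose ≠ i := fun h' => hne (by rw [h'])
    obtain ⟨h1, h2⟩ := h.choose_spec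
    have : c ≠ o i := by
      rintro rfl
      exact upper_not_le hne'.symm h1
    obtain ⟨v, hv, hcv⟩ := exists_neighborOf hci this
    exact hf _ _ (upper_antipodal hne' hv (hcv.mono h1 hv) (hcv.mono hci hv)) (h2 ▸ hfi)
  have g_last : ∀ c, (∀ i, c ≤ (o i : Gam G Q) → f c ≠ f (o i)) → g c = Fin.last _ := by
    intro c h
    exact dif_neg (by rintro ⟨i, h1, h2⟩; exact h i h1 h2)
  have g_D₁ : ∀ i, ∀ c ∈ D₁ o i, f c ≠ f (o i) → g c = Fin.last _ := by
    intro i c hc hne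
    refine g_last c fun k hk => ?_
    by_cases hki : k = i
    · exact hki ▸ hne
    · exact absurd hk (hc.2 k hki)
  refine ⟨g, ?_, ?_, ?_, ?_, ?_, ?_⟩
  · exact fun i => g_eq _ i le_rfl rfl
  · intro i c hc
    by_cases h : f c = f (o i)
    · exact Or.inl (g_eq c i hc.1 h)
    · exact Or.inr (g_D₁ i c hc h)
  · intro i j hij c hc
    rcases color_mem_of_mem_D₂ hf hf2 hij hc with h | h
    · exact Or.inl (g_eq c i hc.1 h)
    · exact Or.inr (g_eq c j hc.2.1 h)
  · rintro i c hc ⟨w, hw, hcw⟩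
    exact g_eq c i hc.1 (color_eq_of_antipodal_upper hf hf2 hw hc.1 hcw)
  -- The class `c'` is antipodal to `u_j`, which sees their common vertex through `c`; this forces
  -- `c'` to have the color of `u_i`, which `c` must then avoid.
  · have key : ∀ i j, i ≠ j → ∀ c, c ≤ (o i : Gam G Q) → c ≤ (o j : Gam G Q) →
        ∀ c' ∈ D₁ o i, c.Antipodal c' → f c ≠ f (o i) := by
      intro i j hij c hci hcj c' hc' hcc'
      obtain ⟨v, hv, h, h'⟩ := attached_iff.mp hcc'.1
      have := antipodal_of_not_le_upper (o j).2 (hc'.2 j hij.symm) hv h' (h.mono hcj hv)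
      rw [← color_eq_of_antipodal_upper hf hf2 (o j).2 hc'.1 this]
      exact hf _ _ hcc'
    intro i j hij c hc
    constructor
    · rintro ⟨c', hc', h⟩
      exact g_eq c j hc.2.1 ((color_mem_of_mem_D₂ hf hf2 hij hc).resolve_left
        (key i j hij.ne c hc.1 hc.2.1 c' hc' h))
    · rintro ⟨c', hc', h⟩
      exact g_eq c i hc.1 ((color_mem_of_mem_D₂ hf hf2 hij hc).resolve_right
        (key j i hij.ne' c hc.2.1 hc.1 c' hc' h))
  · rintro D (⟨i, rfl⟩ | ⟨i, j, hij, rfl⟩) c hc c' hc' hcc' hg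
    · obtain ⟨v, hv, h, h'⟩ := attached_iff.mp hcc'.1
      by_cases h1 : f c = f (o i)
      · by_cases h2 : f c' = f (o i)
        · exact hf _ _ hcc' (h1.trans h2.symm)
        · rw [g_eq c i hc.1 h1, g_D₁ i c' hc' h2] at hg
          exact Fin.castSucc_ne_last i hg
      · by_cases h2 : f c' = f (o i)
        · rw [g_eq c' i hc'.1 h2, g_D₁ i c hc h1] at hg
          exact Fin.castSucc_ne_last i hg.symm
        -- If both colors differ from that of `u_i`, then `c`, `c'` and `u_i` would show three
        -- colors at `v`.
        · rcases hf2 v hv c c' (o i) h h' (h.mono hc.1 hv) with h3 | h3 | h3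
          · exact hf _ _ hcc' h3
          · exact h1 h3
          · exact h2 h3
    · have key : ∀ c ∈ D₂ o i j, (g c = i.castSucc ∧ f c = f (o i)) ∨
          (g c = j.castSucc ∧ f c = f (o j)) := by
        intro c hc
        rcases color_mem_of_mem_D₂ hf hf2 hij hc with h | h
        · exact Or.inl ⟨g_eq c i hc.1 h, h⟩
        · exact Or.inr ⟨g_eq c j hc.2.1 h, h⟩
      have hij' : i.castSucc ≠ j.castSucc := fun h => hij.ne (Fin.castSucc_injective _ h)
      rcases key c hc with ⟨h1, h2⟩ | ⟨h1, h2⟩ <;> rcases key c' hc' with ⟨h3, h4⟩ | ⟨h3, h4⟩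
      · exact hf _ _ hcc' (h2.trans h4.symm)
      · exact hij' (h1 ▸ h3 ▸ hg)
      · exact hij' (h1 ▸ h3 ▸ hg.symm)
      · exact hf _ _ hcc' (h2.trans h4.symm)

end StrongToWeak

/-- Neighborhoods in `Q` do not depend on the representative of a class, so a choice of
representatives transfers the coloring to the quotient. -/
theorem StrongColorable.weak (h : StrongColorable G Q) (o : UpperOrdering G Q) :
    (¬ ∃ a ∈ Upper G Q, ∃ b ∈ Upper G Q, ∃ c ∈ Upper G Q, IsFullAntipodalTriple a b c) ∧
      ∃ f : Gam G Q → Fin (ell G Q + 1), IsWeakColoring o f := by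
  obtain ⟨α, f, h1, h2⟩ := h
  let r : Gam G Q → SepPart G Q := ofAntisymmetrization (· ≤ ·)
  have hr : ∀ c, (r c).cls = c := toAntisymmetrization_ofAntisymmetrization _
  have hnb : ∀ c : Gam G Q, ∀ v ∈ Q, c.NeighborOf v → (r c).NeighborOf v := fun c v hv h =>
    (SepPart.neighborOf_cls hv).mp ((hr c).symm ▸ h)
  have h1' : ∀ c c' : Gam G Q, c.Antipodal c' → f (r c) ≠ f (r c') := by
    intro c c' hcc' he
    obtain ⟨v, hv, h, h'⟩ := attached_iff.mp hcc'.1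
    rcases h1 _ _ (SepPart.attached_iff.mpr ⟨v, hv, hnb c v hv h, hnb c' v hv h'⟩) he with h | h
    · rw [← SepPart.cls_le_cls, hr, hr] at h
      exact hcc'.2.1 h
    · rw [← SepPart.cls_le_cls, hr, hr] at h
      exact hcc'.2.2 h
  have h2' : ∀ v ∈ Q, ∀ a b c : Gam G Q, a.NeighborOf v → b.NeighborOf v → c.NeighborOf v →
      f (r a) = f (r b) ∨ f (r a) = f (r c) ∨ f (r b) = f (r c) := fun v hv a b c ha hb hc =>
    h2 v hv _ _ _ (hnb a v hv ha) (hnb b v hv hb) (hnb c v hv hc)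
  refine ⟨?_, exists_weakColoring_of_strong (f := fun c => f (r c)) h1' h2' o⟩
  rintro ⟨a, -, b, -, c, -, h⟩
  exact no_triple_of_strong (f := fun c => f (r c)) h1' h2' a b c h

/-! ### From a weak to a strong coloring. -/

section WeakToStrong

variable {o : UpperOrdering G Q} {g : Gam G Q → Fin (ell G Q + 1)}
  (hT : ¬ ∃ a ∈ Upper G Q, ∃ b ∈ Upper G Q, ∃ c ∈ Upper G Q, IsFullAntipodalTriple a b c)
  (hg : IsWeakColoring o g)

include hT in
theorem upper_eq_of_neighborOf {v : V} (hv : v ∈ Q) {i j k : Fin (ell G Q)} (hij : i ≠ j)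
    (hi : Gam.NeighborOf (o i : Gam G Q) v) (hj : Gam.NeighborOf (o j : Gam G Q) v)
    (hk : Gam.NeighborOf (o k : Gam G Q) v) : k = i ∨ k = j := by
  by_contra! h
  exact hT ⟨_, (o i).2, _, (o j).2, _, (o k).2, upper_antipodal hij hv hi hj,
    upper_antipodal h.1.symm hv hi hk, upper_antipodal h.2.symm hv hj hk, v, hv, hi, hj, hk⟩

variable [Finite V]

-- A class below two upper elements sees some vertex of `Q`, and every upper element above the class
-- sees it too; without a full antipodal triple there are only two of these.
include hT in
theorem mem_D₁_or_mem_D₂ (c : Gam G Q) :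
    (∃ i, c ∈ D₁ o i) ∨ ∃ i j, i < j ∧ c ∈ D₂ o i j := by
  obtain ⟨i, hi⟩ := exists_le_upper o c
  by_cases h : ∃ j, j ≠ i ∧ c ≤ (o j : Gam G Q)
  · obtain ⟨j, hji, hj⟩ := h
    have hne : c ≠ o i := by
      rintro rfl
      exact upper_not_le hji.symm hj
    obtain ⟨v, hv, hc⟩ := exists_neighborOf hi hne
    have key : ∀ k, c ≤ (o k : Gam G Q) → k = i ∨ k = j := fun k hk =>
      upper_eq_of_neighborOf hT hv hji.symm (hc.mono hi hv) (hc.mono hj hv) (hc.mono hk hv)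
    right
    rcases lt_or_gt_of_ne hji with h | h
    · exact ⟨j, i, h, hj, hi, fun k h1 h2 h3 => (key k h3).elim h2 h1⟩
    · exact ⟨i, j, h, hi, hj, fun k h1 h2 h3 => (key k h3).elim h1 h2⟩
  · push Not at h
    exact Or.inl ⟨i, hi, h⟩

include hT hg in
/-- At a vertex seen by two upper elements, every color is that of one of them. -/
theorem color_of_two_upper {v : V} (hv : v ∈ Q) {i j : Fin (ell G Q)} (hij : i ≠ j)
    (hi : Gam.NeighborOf (o i : Gam G Q) v) (hj : Gam.NeighborOf (o j : Gam G Q) v)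
    {c : Gam G Q} (hc : c.NeighborOf v) : g c = i.castSucc ∨ g c = j.castSucc := by
  have key : ∀ k, c ≤ (o k : Gam G Q) → k = i ∨ k = j := fun k hk =>
    upper_eq_of_neighborOf hT hv hij hi hj (hc.mono hk hv)
  rcases mem_D₁_or_mem_D₂ hT (o := o) c with ⟨k, hk⟩ | ⟨k, l, hkl, h⟩
  · rcases key k hk.1 with rfl | rfl
    · left
      exact hg.single_antipodal k c hk ⟨_, (o j).2,
        antipodal_of_not_le_upper (o j).2 (hk.2 j hij.symm) hv hc hj⟩
    · right
      exact hg.single_antipodal k c hk ⟨_, (o i).2,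
        antipodal_of_not_le_upper (o i).2 (hk.2 i hij) hv hc hi⟩
  · have h1 := key k h.1
    have h2 := key l h.2.1
    rcases hg.double k l hkl c h with h3 | h3
    · rcases h1 with rfl | rfl
      · exact Or.inl h3
      · exact Or.inr h3
    · rcases h2 with rfl | rfl
      · exact Or.inl h3
      · exact Or.inr h3

include hT hg in
theorem color_of_one_upper {v : V} (hv : v ∈ Q) {i : Fin (ell G Q)}
    (hi : ∀ j, Gam.NeighborOf (o j : Gam G Q) v → j = i) {c : Gam G Q} (hc : c.NeighborOf v) :
    c ∈ D₁ o i ∧ (g c = i.castSucc ∨ g c = Fin.last _) := by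
  rcases mem_D₁_or_mem_D₂ hT (o := o) c with ⟨k, hk⟩ | ⟨k, l, hkl, h⟩
  · obtain rfl := hi k (hc.mono hk.1 hv)
    exact ⟨hk, hg.single k c hk⟩
  · exact absurd ((hi k (hc.mono h.1 hv)).trans (hi l (hc.mono h.2.1 hv)).symm) hkl.ne

-- The argument is local at a vertex `v` seen by both classes. If `v` sees one upper element, both
-- classes lie in one `D₁`. If it sees two, classes in a `D₁` are antipodal to the other upper
-- element, which fixes their color, and the mixed cases are conditions (d) and (e).
include hT hg in
theorem color_ne_of_antipodal {c c' : Gam G Q} (hcc' : c.Antipodal c') : g c ≠ g c' := by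
  obtain ⟨v, hv, hc, hc'⟩ := attached_iff.mp hcc'.1
  obtain ⟨i, hci⟩ := exists_le_upper o c
  have hi := hc.mono hci hv
  by_cases h : ∃ j, j ≠ i ∧ Gam.NeighborOf (o j : Gam G Q) v
  · obtain ⟨j, hji, hj⟩ := h
    have key : ∀ k, Gam.NeighborOf (o k : Gam G Q) v → k = i ∨ k = j := fun k hk =>
      upper_eq_of_neighborOf hT hv hji.symm hi hj hk
    -- The minimum and maximum appear because the double conditions are stated for increasing pairs
    -- of indices only.
    have cover : ∀ c : Gam G Q, c.NeighborOf v → c ∈ D₁ o i ∨ c ∈ D₁ o j ∨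
        (c ∈ D₂ o (min i j) (max i j)) := by
      intro d hd
      rcases mem_D₁_or_mem_D₂ hT (o := o) d with ⟨k, hk⟩ | ⟨k, l, hkl, h⟩
      · rcases key k (hd.mono hk.1 hv) with rfl | rfl
        · exact Or.inl hk
        · exact Or.inr (Or.inl hk)
      · right; right
        have hk := key k (hd.mono h.1 hv)
        have hl := key l (hd.mono h.2.1 hv)
        have : min i j = k ∧ max i j = l := by
          rcases hk with rfl | rfl <;> rcases hl with rfl | rfl
          · exact absurd hkl (lt_irrefl _)
          · exact ⟨min_eq_left hkl.le, max_eq_right hkl.le⟩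
          · exact ⟨min_eq_right hkl.le, max_eq_left hkl.le⟩
          · exact absurd hkl (lt_irrefl _)
        rw [this.1, this.2]
        exact h
    have hlt : min i j < max i j := min_lt_max.mpr hji.symm
    have single : ∀ k l, k ≠ l → Gam.NeighborOf (o l : Gam G Q) v → ∀ d ∈ D₁ o k,
        d.NeighborOf v → g d = k.castSucc := fun k l hkl hl d hd hdv =>
      hg.single_antipodal k d hd ⟨_, (o l).2,
        antipodal_of_not_le_upper (o l).2 (hd.2 l hkl.symm) hv hdv hl⟩
    have hne : i.castSucc ≠ j.castSucc := fun h => hji (Fin.castSucc_injective _ h).symm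
    have double : ∀ d ∈ D₂ o (min i j) (max i j), ∀ e,
        (e ∈ D₁ o i → d.Antipodal e → g d = j.castSucc) ∧
        (e ∈ D₁ o j → d.Antipodal e → g d = i.castSucc) := by
      intro d hd e
      have := hg.double_antipodal _ _ hlt d hd
      rcases lt_or_gt_of_ne hji with h | h
      · rw [min_eq_right h.le, max_eq_left h.le] at this
        exact ⟨fun h1 h2 => this.2 ⟨e, h1, h2⟩, fun h1 h2 => this.1 ⟨e, h1, h2⟩⟩
      · rw [min_eq_left h.le, max_eq_right h.le] at this
        exact ⟨fun h1 h2 => this.1 ⟨e, h1, h2⟩, fun h1 h2 => this.2 ⟨e, h1, h2⟩⟩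
    rcases cover c hc with h1 | h1 | h1 <;> rcases cover c' hc' with h2 | h2 | h2
    · exact hg.proper _ (Or.inl ⟨i, rfl⟩) c h1 c' h2 hcc'
    · rw [single i j hji.symm hj c h1 hc, single j i hji hi c' h2 hc']
      exact hne
    · rw [single i j hji.symm hj c h1 hc, (double c' h2 c).1 h1 hcc'.symm]
      exact hne
    · rw [single i j hji.symm hj c' h2 hc', single j i hji hi c h1 hc]
      exact hne.symm
    · exact hg.proper _ (Or.inl ⟨j, rfl⟩) c h1 c' h2 hcc'
    · rw [single j i hji hi c h1 hc, (double c' h2 c).2 h1 hcc'.symm]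
      exact hne.symm
    · rw [single i j hji.symm hj c' h2 hc', (double c h1 c').1 h2 hcc']
      exact hne.symm
    · rw [single j i hji hi c' h2 hc', (double c h1 c').2 h2 hcc']
      exact hne
    · exact hg.proper _ (Or.inr ⟨_, _, hlt, rfl⟩) c h1 c' h2 hcc'
  · have h' : ∀ j, Gam.NeighborOf (o j : Gam G Q) v → j = i := by
      intro j hj
      by_contra hne
      exact h ⟨j, hne, hj⟩
    exact hg.proper _ (Or.inl ⟨i, rfl⟩) c (color_of_one_upper hT hg hv h' hc).1 c'
      (color_of_one_upper hT hg hv h' hc').1 hcc'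

include hT hg in
theorem strongColorable_of_weak : StrongColorable G Q := by
  refine ⟨ULift (Fin (ell G Q + 1)), fun a => ⟨g a.cls⟩, ?_, ?_⟩
  · intro a b hab h
    by_contra! hne
    refine color_ne_of_antipodal hT hg (c := a.cls) (c' := b.cls) ⟨⟨a, b, rfl, rfl, hab⟩, ?_, ?_⟩
      (ULift.up_injective h)
    · exact fun h => hne.1 (SepPart.cls_le_cls.mp h)
    · exact fun h => hne.2 (SepPart.cls_le_cls.mp h)
  · intro v hv a b c ha hb hc
    simp only [ULift.up_inj]
    have pigeon : ∀ x y : Fin (ell G Q + 1), (∀ d : Gam G Q, d.NeighborOf v → g d = x ∨ g d = y) →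
        g a.cls = g b.cls ∨ g a.cls = g c.cls ∨ g b.cls = g c.cls := by
      intro x y h
      have h1 := h a.cls ⟨a, rfl, ha⟩
      have h2 := h b.cls ⟨b, rfl, hb⟩
      have h3 := h c.cls ⟨c, rfl, hc⟩
      grind
    obtain ⟨i, hci⟩ := exists_le_upper o a.cls
    have hi : Gam.NeighborOf (o i : Gam G Q) v := NeighborOf.mono hci hv ⟨a, rfl, ha⟩
    by_cases h : ∃ j, j ≠ i ∧ Gam.NeighborOf (o j : Gam G Q) v
    · obtain ⟨j, hji, hj⟩ := h
      exact pigeon _ _ fun d hd => color_of_two_upper hT hg hv hji.symm hi hj hd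
    · have h' : ∀ j, Gam.NeighborOf (o j : Gam G Q) v → j = i := by
        intro j hj
        by_contra hne
        exact h ⟨j, hne, hj⟩
      exact pigeon _ _ fun d hd => (color_of_one_upper hT hg hv h' hd).2

end WeakToStrong

end Coloring

open SimpleGraph

/-! ### Rooted trees, subtrees and the Helly property. -/

section Tree

variable {W : Type u} {T : SimpleGraph W}

theorem isPath_append {a b c : W} {p : T.Walk a b} {q : T.Walk b c} (hp : p.IsPath)
    (hq : q.IsPath) (h : ∀ x ∈ p.support, x ∈ q.support → x = b) : (p.append q).IsPath := by
  induction p with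
  | nil => simpa using hq
  | cons e p ih =>
    rw [Walk.cons_append, Walk.cons_isPath_iff]
    rw [Walk.cons_isPath_iff] at hp
    refine ⟨ih hp.1 hq fun x hx => h x (by simp [hx]), fun hmem => ?_⟩
    rw [Walk.mem_support_append_iff] at hmem
    rcases hmem with hmem | hmem
    · exact hp.2 hmem
    · have := h _ (by simp) hmem
      exact hp.2 (this ▸ p.end_mem_support)

/-- `x` is an ancestor of `y` with respect to the root `r`: every walk from `r` to `y` visits
`x`. -/
def Anc (T : SimpleGraph W) (r x y : W) : Prop := ∀ p : T.Walk r y, x ∈ p.support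

theorem Anc.refl (r y : W) : Anc T r y y := fun p => p.end_mem_support

theorem Anc.trans {r x y z : W} (hxy : Anc T r x y) (hyz : Anc T r y z) : Anc T r x z := by
  classical
  intro p
  exact p.support_takeUntil_subset_support (hyz p) (hxy _)

theorem Anc.antisymm (hT : T.Connected) {r x y : W} (hxy : Anc T r x y) (hyx : Anc T r y x) :
    x = y := by
  classical
  obtain ⟨p, hp⟩ := hT.exists_isPath r y
  by_contra hne
  exact Walk.endpoint_notMem_support_takeUntil hp (hxy p) (Ne.symm hne) (hyx _)

theorem anc_iff_mem_support (hT : T.IsAcyclic) {r x y : W} {p : T.Walk r y} (hp : p.IsPath) :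
    Anc T r x y ↔ x ∈ p.support := by
  classical
  refine ⟨fun h => h p, fun h q => ?_⟩
  have : q.bypass = p := congrArg Subtype.val
    ((hT.subsingleton_path r y).elim ⟨_, q.bypass_isPath⟩ ⟨p, hp⟩)
  exact q.support_bypass_subset_support (this ▸ h)

theorem anc_getVert (hT : T.IsAcyclic) {r z : W} {p : T.Walk r z} (hp : p.IsPath) {i j : ℕ}
    (hij : i ≤ j) : Anc T r (p.getVert i) (p.getVert j) := by
  rw [anc_iff_mem_support hT (hp.take j)]
  have := (p.take j).getVert_mem_support i
  rwa [Walk.take_getVert, min_eq_right hij] at this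

theorem Anc.total (hT : T.IsTree) {r x y z : W} (hx : Anc T r x z) (hy : Anc T r y z) :
    Anc T r x y ∨ Anc T r y x := by
  obtain ⟨p, hp⟩ := hT.1.exists_isPath r z
  obtain ⟨i, rfl, -⟩ := Walk.mem_support_iff_exists_getVert.mp (hx p)
  obtain ⟨j, rfl, -⟩ := Walk.mem_support_iff_exists_getVert.mp (hy p)
  rcases le_total i j with h | h
  · exact Or.inl (anc_getVert hT.2 hp h)
  · exact Or.inr (anc_getVert hT.2 hp h)

theorem Anc.dist_lt (hT : T.Connected) {r x y : W} (h : Anc T r x y) (hne : x ≠ y) :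
    T.dist r x < T.dist r y := by
  classical
  obtain ⟨p, hp⟩ := hT.exists_walk_length_eq_dist r y
  rw [← hp]
  exact (dist_le _).trans_lt (Walk.length_takeUntil_lt_length (h p) hne)

/-- Any two vertices of `A` are joined by a walk inside `A`. -/
def ConnIn (T : SimpleGraph W) (A : Set W) : Prop :=
  ∀ x ∈ A, ∀ y ∈ A, ∃ p : T.Walk x y, ∀ z ∈ p.support, z ∈ A

/-- The top is a vertex of `A` nearest to the root: a path from the root to it meets `A` only at its
end, so it extends by a path inside `A` to any other vertex of `A`. -/
theorem ConnIn.exists_top (hT : T.IsTree) {A : Set W} (hA : ConnIn T A) (hne : A.Nonempty)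
    (r : W) : ∃ t ∈ A, ∀ z ∈ A, Anc T r t z := by
  classical
  obtain ⟨t, ht, hmin⟩ : ∃ t ∈ A, ∀ z ∈ A, T.dist r t ≤ T.dist r z := by
    obtain ⟨t, ht⟩ := exists_minimalFor_of_wellFoundedLT (· ∈ A) (T.dist r) hne
    refine ⟨t, ht.1, fun z hz => ?_⟩
    by_contra h
    exact h (ht.2 hz (not_le.mp h).le)
  refine ⟨t, ht, fun z hz => ?_⟩
  obtain ⟨p, hp, hpl⟩ := hT.1.exists_path_of_dist r t
  obtain ⟨q, hq⟩ := hA t ht z hz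
  have hpath : (p.append q.bypass).IsPath := by
    refine isPath_append hp q.bypass_isPath fun x hx hx' => ?_
    by_contra hne
    have h1 := hmin x (hq x (q.support_bypass_subset_support hx'))
    have h2 := Anc.dist_lt hT.1 ((anc_iff_mem_support hT.2 hp).mpr hx) hne
    omega
  rw [anc_iff_mem_support hT.2 hpath]
  simp

/-- A walk to `z` can be routed through `t` and then inside `A`; it must visit `y`, and before `t`
it could do so only if `y = t`. -/
theorem ConnIn.mem_of_anc (hT : T.IsTree) {A : Set W} (hA : ConnIn T A) {r t y z : W}
    (ht : t ∈ A) (hz : z ∈ A) (hty : Anc T r t y) (hyz : Anc T r y z) : y ∈ A := by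
  obtain ⟨p, hp⟩ := hT.1.exists_isPath r t
  obtain ⟨q, hq⟩ := hA t ht z hz
  have := hyz (p.append q)
  rw [Walk.mem_support_append_iff] at this
  rcases this with h | h
  · rwa [← Anc.antisymm hT.1 hty ((anc_iff_mem_support hT.2 hp).mpr h)]
  · exact hq y h

/-- The Helly property of subtrees. -/
theorem exists_common_mem (hT : T.IsTree) {ι : Type*} [Finite ι] {A : ι → Set W}
    (hA : ∀ i, ConnIn T (A i)) (hne : ∀ i j, (A i ∩ A j).Nonempty) : ∃ q, ∀ i, q ∈ A i := by
  have : Nonempty W := hT.1.nonempty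
  let r : W := Classical.arbitrary W
  rcases isEmpty_or_nonempty ι with h | h
  · exact ⟨r, fun i => h.elim i⟩
  choose t ht htop using fun i => (hA i).exists_top hT ((hne i i).mono Set.inter_subset_left) r
  -- The deepest of the tops is the common node.
  obtain ⟨i, hi⟩ := Finite.exists_max fun i => T.dist r (t i)
  refine ⟨t i, fun j => ?_⟩
  obtain ⟨z, hzi, hzj⟩ := hne i j
  refine (hA j).mem_of_anc hT (ht j) hzj ?_ (htop i z hzi)
  rcases (htop i z hzi).total hT (htop j z hzj) with h | h
  · by_cases he : t i = t j
    · rw [he]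
      exact Anc.refl _ _
    · have := h.dist_lt hT.1 he
      have := hi j
      omega
  · exact h

theorem IsPathVertexSet.nonempty {P : Set W} (hP : IsPathVertexSet T P) : P.Nonempty := by
  obtain ⟨a, b, p, -, rfl⟩ := hP
  exact ⟨a, p.start_mem_support⟩

theorem IsPathVertexSet.connIn {P : Set W} (hP : IsPathVertexSet T P) : ConnIn T P := by
  classical
  obtain ⟨a, b, p, -, rfl⟩ := hP
  intro x hx y hy
  refine ⟨(p.takeUntil x hx).reverse.append (p.takeUntil y hy), fun z hz => ?_⟩
  rw [Walk.mem_support_append_iff, Walk.support_reverse, List.mem_reverse] at hz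
  rcases hz with hz | hz
  · exact p.support_takeUntil_subset_support hx hz
  · exact p.support_takeUntil_subset_support hy hz

/-- A path through the root consists of the ancestors of its two ends. -/
theorem IsPathVertexSet.exists_ends (hT : T.IsTree) {P : Set W} (hP : IsPathVertexSet T P) {q : W}
    (hq : q ∈ P) : ∃ e₁ e₂, (∀ z, z ∈ P ↔ Anc T q z e₁ ∨ Anc T q z e₂) ∧
      ∀ z, Anc T q z e₁ → Anc T q z e₂ → z = q := by
  classical
  obtain ⟨a, b, p, hp, rfl⟩ := hP
  have h1 : ∀ z, Anc T q z a ↔ z ∈ (p.takeUntil q hq).support := fun z => by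
    rw [anc_iff_mem_support hT.2 (hp.takeUntil hq).reverse]
    simp
  have h2 : ∀ z, Anc T q z b ↔ z ∈ (p.dropUntil q hq).support := fun z =>
    anc_iff_mem_support hT.2 (hp.dropUntil hq)
  refine ⟨a, b, fun z => ?_, fun z hz1 hz2 => ?_⟩
  · rw [h1, h2, ← Walk.mem_support_append_iff, Walk.take_spec]
    rfl
  · rw [h1] at hz1
    rw [h2] at hz2
    by_contra hne
    have hp' := hp
    rw [← p.take_spec hq] at hp'
    exact hp'.ne_of_mem_support_of_append hne hz1 hz2 rfl

theorem exists_adj_anc (hT : T.IsTree) {q t : W} (h : t ≠ q) : ∃ b, T.Adj q b ∧ Anc T q b t := by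
  obtain ⟨p, hp⟩ := hT.1.exists_isPath q t
  have hnil : ¬ p.Nil := fun h' => h h'.eq.symm
  refine ⟨p.snd, p.adj_snd hnil, ?_⟩
  rw [anc_iff_mem_support hT.2 hp]
  exact p.getVert_mem_support 1

theorem eq_of_adj_of_anc {q b b' : W} (hb : T.Adj q b) (hb' : T.Adj q b')
    (h : Anc T q b b') : b = b' := by
  have := h (Walk.cons hb' Walk.nil)
  simp only [Walk.support_cons, Walk.support_nil, List.mem_cons, List.not_mem_nil, or_false] at this
  exact this.resolve_left hb.ne'

end Tree

/-! ### Path graphs have strong colorings. -/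

section Forward

variable {V : Type u} {G : SimpleGraph V} {Q : Set V}

theorem SepPart.adj_mem_verts {γ : SepPart G Q} {c d : V} (hc : c ∈ γ.comp.supp)
    (h : G.Adj c d) : d ∈ γ.comp.supp ∪ Q := by
  by_cases hd : d ∈ Q
  · exact Or.inr hd
  · exact Or.inl (ComponentCompl.mem_of_adj c d hc hd h)

theorem SepPart.notMem_of_mem_supp {γ : SepPart G Q} {c : V} (hc : c ∈ γ.comp.supp) : c ∉ Q :=
  hc.choose

theorem SepPart.eq_of_mem_supp {γ γ' : SepPart G Q} {c : V} (hc : c ∈ γ.comp.supp)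
    (hc' : c ∈ γ'.comp.supp) : γ = γ' :=
  SepPart.ext (hc.choose_spec.symm.trans hc'.choose_spec)

theorem SepPart.supp_nonempty (γ : SepPart G Q) : γ.comp.supp.Nonempty :=
  ComponentCompl.nonempty γ.comp

theorem SepPart.Relevant.isClique {γ : SepPart G Q} {K : Set V} (h : γ.Relevant K) :
    G.IsClique K := h.1.1.2

/-- Otherwise the relevant clique lies in `Q`, and its maximality makes it equal to `Q`, which is
excluded. -/
theorem SepPart.Relevant.exists_mem_supp {γ : SepPart G Q} (hQ : G.IsClique Q) {K : Set V}
    (h : γ.Relevant K) : ∃ c ∈ K, c ∈ γ.comp.supp := by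
  by_contra! hne
  have hKQ : K ⊆ Q := fun x hx => (h.1.1.1 hx).resolve_left (hne x hx)
  exact h.2.2 (hKQ.antisymm (h.1.2 ⟨Set.subset_union_right, hQ⟩ hKQ))

theorem SepPart.NeighborOf.exists_adj {γ : SepPart G Q} (hQ : G.IsClique Q) {v : V}
    (h : γ.NeighborOf v) (hv : v ∈ Q) : ∃ c ∈ γ.comp.supp, G.Adj v c := by
  obtain ⟨K, hK, hvK⟩ := h
  obtain ⟨c, hcK, hc⟩ := hK.exists_mem_supp hQ
  exact ⟨c, hc, hK.isClique hvK hcK fun h => SepPart.notMem_of_mem_supp hc (h ▸ hv)⟩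

theorem SepPart.connIn_biUnion {γ : SepPart G Q} {W : Type u} {T : SimpleGraph W}
    {φ : V → Set W} (hφ : ∀ v, ConnIn T (φ v))
    (hadj : ∀ v w, G.Adj v w → (φ v ∩ φ w).Nonempty) :
    ConnIn T (⋃ v ∈ γ.comp.supp, φ v) := by
  have key : ∀ {u v : ↥Qᶜ} (p : (G.induce Qᶜ).Walk u v), (u : V) ∈ γ.comp.supp → ∀ x ∈ φ u,
      ∀ y ∈ φ v, ∃ p : T.Walk x y, ∀ z ∈ p.support, z ∈ ⋃ v ∈ γ.comp.supp, φ v := by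
    intro u v p
    induction p with
    | nil =>
      intro hu x hx y hy
      obtain ⟨p, hp⟩ := hφ _ x hx y hy
      exact ⟨p, fun z hz => Set.mem_biUnion hu (hp z hz)⟩
    | @cons u w v e p ih =>
      intro hu x hx y hy
      have hw : (w : V) ∈ γ.comp.supp := ComponentCompl.mem_of_adj _ _ hu w.2 e
      obtain ⟨m, hmu, hmw⟩ := hadj u w e
      obtain ⟨p₁, hp₁⟩ := hφ _ x hx m hmu
      obtain ⟨p₂, hp₂⟩ := ih hw m hmw y hy
      refine ⟨p₁.append p₂, fun z hz => ?_⟩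
      rw [Walk.mem_support_append_iff] at hz
      rcases hz with hz | hz
      · exact Set.mem_biUnion hu (hp₁ z hz)
      · exact hp₂ z hz
  intro x hx y hy
  obtain ⟨u, hu, hxu⟩ := Set.mem_iUnion₂.mp hx
  obtain ⟨v, hv, hyv⟩ := Set.mem_iUnion₂.mp hy
  have : (G.induce Qᶜ).Reachable ⟨u, hu.choose⟩ ⟨v, hv.choose⟩ :=
    ConnectedComponent.exact (hu.choose_spec.trans hv.choose_spec.symm)
  obtain ⟨p⟩ := this
  exact key p hu x hxu y hyv

/-- Root the tree at a node `q` common to the paths of `Q`; by maximality of `Q` no other path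
contains `q`. The subtrees `S γ` are pairwise disjoint and miss `q`. The color of `γ` is the
neighbor `b γ` of `q` towards the top `t γ` of its subtree. -/
theorem IsPathGraph.strongColorable [Finite V] (hG : IsPathGraph G) (hQ : Maximal G.IsClique Q) :
    StrongColorable G Q := by
  obtain ⟨W, hW, T, φ, hT, hφ, -, hadj⟩ := hG
  have hconn : ∀ v, ConnIn T (φ v) := fun v => (hφ v).connIn
  have hne : ∀ v, (φ v).Nonempty := fun v => (hφ v).nonempty
  have hadj' : ∀ v w, G.Adj v w → (φ v ∩ φ w).Nonempty := fun v w h => (hadj v w h.ne).mp h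
  -- every clique has a common node
  have helly : ∀ K : Set V, G.IsClique K → ∃ q, ∀ v ∈ K, q ∈ φ v := by
    intro K hK
    obtain ⟨q, hq⟩ := exists_common_mem hT (ι := K) (A := fun v => φ v) (fun v => hconn v) (by
      intro v w
      by_cases h : (v : V) = w
      · rw [h, Set.inter_self]
        exact hne w
      · exact hadj' _ _ (hK v.2 w.2 h))
    exact ⟨q, fun v hv => hq ⟨v, hv⟩⟩
  have adj_of_mem : ∀ {x v w}, v ≠ w → x ∈ φ v → x ∈ φ w → G.Adj v w := fun h hv hw =>
    (hadj _ _ h).mpr ⟨_, hv, hw⟩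
  obtain ⟨q, hq⟩ := helly Q hQ.1
  have hq' : ∀ v, q ∈ φ v → v ∈ Q := by
    intro v hv
    by_contra hvQ
    refine hvQ (hQ.2 (y := insert v Q) ?_ (Set.subset_insert v Q) (Set.mem_insert v Q))
    exact hQ.1.insert fun w hw hvw => adj_of_mem hvw hv (hq w hw)
  let S : SepPart G Q → Set W := fun γ => ⋃ v ∈ γ.comp.supp, φ v
  have hS : ∀ γ, ConnIn T (S γ) := fun γ => SepPart.connIn_biUnion hconn hadj'
  have hSne : ∀ γ, (S γ).Nonempty := fun γ => by
    obtain ⟨c, hc⟩ := γ.supp_nonempty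
    exact (hne c).mono (Set.subset_biUnion_of_mem hc)
  have hSdisj : ∀ γ γ' x, x ∈ S γ → x ∈ S γ' → γ = γ' := by
    intro γ γ' x hx hx'
    obtain ⟨u, hu, hxu⟩ := Set.mem_iUnion₂.mp hx
    obtain ⟨v, hv, hxv⟩ := Set.mem_iUnion₂.mp hx'
    by_cases h : u = v
    · exact SepPart.eq_of_mem_supp hu (h ▸ hv)
    · exact SepPart.eq_of_mem_supp (ComponentCompl.mem_of_adj u v hu
        (SepPart.notMem_of_mem_supp hv) (adj_of_mem h hxu hxv)) hv
  choose t ht htop using fun γ => (hS γ).exists_top hT (hSne γ) q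
  have htq : ∀ γ, t γ ≠ q := by
    intro γ h
    obtain ⟨u, hu, hxu⟩ := Set.mem_iUnion₂.mp (ht γ)
    exact SepPart.notMem_of_mem_supp hu (hq' u (h ▸ hxu))
  choose b hb hbt using fun γ => exists_adj_anc hT (htq γ)
  -- the path of a vertex of `Q` that sees a part visits the top of that part
  have htop_mem : ∀ v ∈ Q, ∀ γ : SepPart G Q, γ.NeighborOf v → t γ ∈ φ v := by
    intro v hv γ hγ
    obtain ⟨c, hc, hvc⟩ := hγ.exists_adj hQ.1 hv
    obtain ⟨z, hzv, hzc⟩ := hadj' v c hvc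
    obtain ⟨e₁, e₂, he, -⟩ := (hφ v).exists_ends hT (hq v hv)
    have := htop γ z (Set.mem_biUnion hc hzc)
    rw [he] at hzv ⊢
    exact hzv.imp this.trans this.trans
  -- Inside one branch at `q`, a path through `q` runs along only one of its two arms.
  have comparable : ∀ v ∈ Q, ∀ x y c, T.Adj q c → Anc T q c x → Anc T q c y → x ∈ φ v → y ∈ φ v →
      Anc T q x y ∨ Anc T q y x := by
    intro v hv x y c hc hcx hcy hx hy
    obtain ⟨e₁, e₂, he, he'⟩ := (hφ v).exists_ends hT (hq v hv)
    rw [he] at hx hy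
    rcases hx with hx | hx <;> rcases hy with hy | hy
    · exact hx.total hT hy
    · exact absurd (he' c (hcx.trans hx) (hcy.trans hy)) hc.ne'
    · exact absurd (he' c (hcy.trans hy) (hcx.trans hx)) hc.ne'
    · exact hx.total hT hy
  refine ⟨W, b, ?_, ?_⟩
  -- In one branch, the part with the higher top dominates. Let `x` be a common node of the paths of
  -- `K'`. If `x` is above `t γ`, every path of `Q` reaching `t γ` passes `x`, so its vertex is in
  -- `K'`. If not, a vertex of `Q` in both cliques would put `t γ` between `t γ'` and `x`, hence
  -- inside `S γ'`.
  · have main : ∀ γ γ' : SepPart G Q, γ.Attached γ' → b γ = b γ' → Anc T q (t γ') (t γ) →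
        γ ≤ γ' := by
      intro γ γ' hatt hbb htt
      by_cases heq : γ = γ'
      · exact heq.le
      refine Or.inr ⟨hatt, fun K' hK' => ?_⟩
      obtain ⟨x, hx⟩ := helly K' hK'.isClique
      obtain ⟨c', hc'K, hc'⟩ := hK'.exists_mem_supp hQ.1
      have hxS : x ∈ S γ' := Set.mem_biUnion hc' (hx c' hc'K)
      have hmem : ∀ w ∈ Q, x ∈ φ w → w ∈ K' := by
        intro w hw hxw
        by_contra hwK
        refine hwK (hK'.1.2 (y := insert w K') ⟨?_, ?_⟩ (Set.subset_insert w K')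
          (Set.mem_insert w K'))
        · exact Set.insert_subset (Or.inr hw) hK'.1.1.1
        · exact hK'.isClique.insert fun z hz hwz => adj_of_mem hwz hxw (hx z hz)
      by_cases hxt : Anc T q x (t γ)
      · left
        rintro K hK w ⟨hwK, hwQ⟩
        refine ⟨hmem w hwQ ?_, hwQ⟩
        have := htop_mem w hwQ γ ⟨K, hK, hwK⟩
        obtain ⟨e₁, e₂, he, -⟩ := (hφ w).exists_ends hT (hq w hwQ)
        rw [he] at this ⊢
        exact this.imp hxt.trans hxt.trans
      · right
        intro K hK
        refine Set.eq_empty_iff_forall_notMem.mpr ?_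
        rintro w ⟨⟨hwK, hwK'⟩, hwQ⟩
        have h1 := htop_mem w hwQ γ ⟨K, hK, hwK⟩
        have h2 := hx w hwK'
        have h3 := htop γ' x hxS
        rcases comparable w hwQ (t γ) x (b γ) (hb γ) (hbt γ)
          (hbb ▸ (hbt γ').trans h3) h1 h2 with h | h
        · exact heq (hSdisj γ γ' (t γ) (ht γ) ((hS γ').mem_of_anc hT (ht γ') hxS htt h))
        · exact hxt h
    intro γ γ' hatt hbb
    obtain ⟨v, hv, h, h'⟩ := SepPart.attached_iff.mp hatt
    rcases comparable v hv (t γ) (t γ') (b γ) (hb γ) (hbt γ) (hbb ▸ hbt γ')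
      (htop_mem v hv γ h) (htop_mem v hv γ' h') with h1 | h1
    · exact Or.inr (main γ' γ (SepPart.attached_iff.mpr ⟨v, hv, h', h⟩) hbb.symm h1)
    · exact Or.inl (main γ γ' hatt hbb h1)
  · intro v hv γ₁ γ₂ γ₃ h1 h2 h3
    obtain ⟨e₁, e₂, he, -⟩ := (hφ v).exists_ends hT (hq v hv)
    -- The two arms of the path of `v` enter at most two branches at `q`.
    have hbe : ∀ γ : SepPart G Q, γ.NeighborOf v → Anc T q (b γ) e₁ ∨ Anc T q (b γ) e₂ := by
      intro γ hγ
      exact ((he _).mp (htop_mem v hv γ hγ)).imp (hbt γ).trans (hbt γ).trans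
    have huniq : ∀ γ γ' e, Anc T q (b γ) e → Anc T q (b γ') e → b γ = b γ' := by
      intro γ γ' e h h'
      rcases h.total hT h' with h | h
      · exact eq_of_adj_of_anc (hb γ) (hb γ') h
      · exact (eq_of_adj_of_anc (hb γ') (hb γ) h).symm
    rcases hbe γ₁ h1 with h1 | h1 <;> rcases hbe γ₂ h2 with h2 | h2
    · exact Or.inl (huniq _ _ _ h1 h2)
    · rcases hbe γ₃ h3 with h3 | h3
      · exact Or.inr (Or.inl (huniq _ _ _ h1 h3))
      · exact Or.inr (Or.inr (huniq _ _ _ h2 h3))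
    · rcases hbe γ₃ h3 with h3 | h3
      · exact Or.inr (Or.inr (huniq _ _ _ h2 h3))
      · exact Or.inr (Or.inl (huniq _ _ _ h1 h3))
    · exact Or.inl (huniq _ _ _ h1 h2)

end Forward

/-! ### A separator lemma for chordal graphs. -/

section Chordal

variable {V : Type u} {G : SimpleGraph V}

theorem cycleGraph_adj_of_lt {n : ℕ} (hn : 3 ≤ n) {a b : Fin n} (h : a < b) :
    (cycleGraph n).Adj a b ↔ (b : ℕ) = a + 1 ∨ ((a : ℕ) = 0 ∧ (b : ℕ) = n - 1) := by
  rw [cycleGraph_adj', Fin.sub_val_of_le h.le, Fin.coe_sub_iff_lt.mpr h]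
  have := b.2
  have : (a : ℕ) < b := h
  omega

theorem IsChordal.not_cycle (hG : IsChordal G) {n : ℕ} (hn : 4 ≤ n) (F : ℕ → V)
    (hF : ∀ a b, a < b → b < n →
      F a ≠ F b ∧ (G.Adj (F a) (F b) ↔ b = a + 1 ∨ (a = 0 ∧ b = n - 1))) : False := by
  have hinj : Function.Injective fun i : Fin n => F i := by
    intro i j hij
    by_contra hne
    rcases lt_or_gt_of_ne hne with h | h
    · exact (hF i j h j.2).1 hij
    · exact (hF j i h i.2).1 hij.symm
  refine hG n hn ⟨⟨⟨fun i => F i, hinj⟩, ?_⟩⟩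
  intro i j
  change G.Adj (F i) (F j) ↔ _
  rcases lt_trichotomy i j with h | rfl | h
  · rw [cycleGraph_adj_of_lt (by omega) h, (hF i j h j.2).2]
  · simp
  · rw [G.adj_comm, (cycleGraph n).adj_comm, cycleGraph_adj_of_lt (by omega) h, (hF j i h i.2).2]

/-- In a chordal graph, some vertex of a connected set `C` is adjacent to all the vertices of a
clique that have a neighbor in `C`. -/
theorem IsChordal.exists_adj_all [Finite V] (hG : IsChordal G) {C Q : Set V} (hC : ConnIn G C)
    (hne : C.Nonempty) (hQ : G.IsClique Q) (hdisj : ∀ c ∈ C, c ∉ Q) :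
    ∃ c ∈ C, ∀ s ∈ Q, (∃ d ∈ C, G.Adj s d) → G.Adj s c := by
  classical
  -- Choose `c` with the most neighbors in the clique; a missed vertex `s` will produce a long
  -- induced cycle.
  obtain ⟨c, hc, hmax⟩ := (Set.toFinite C).exists_maximalFor
    (fun c => {s ∈ Q | G.Adj s c}.ncard) C hne
  refine ⟨c, hc, fun s hs hsd => ?_⟩
  by_contra hsc
  -- a shortest walk in `C` from `c` to a neighbor of `s`
  obtain ⟨d, hd, hsd⟩ := hsd
  have hex : ∃ n, ∃ y, ∃ p : G.Walk c y, (∀ z ∈ p.support, z ∈ C) ∧ G.Adj s y ∧ p.length = n := by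
    obtain ⟨p, hp⟩ := hC c hc d hd
    exact ⟨_, d, p, hp, hsd, rfl⟩
  obtain ⟨y, p, hpC, hsy, hlen⟩ := Nat.find_spec hex
  have hshort : ∀ w, ∀ q : G.Walk c w, (∀ z ∈ q.support, z ∈ C) → G.Adj s w →
      p.length ≤ q.length := fun w q hq hw => hlen ▸ Nat.find_min' hex ⟨w, q, hq, hw, rfl⟩
  have hgC : ∀ i, p.getVert i ∈ C := fun i => hpC _ (p.getVert_mem_support i)
  have hs_only : ∀ i ≤ p.length, G.Adj (p.getVert i) s → i = p.length := by
    intro i hi h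
    have := hshort _ (p.take i) (fun z hz => hpC z ((p.isSubwalk_take i).support_subset hz)) h.symm
    rw [Walk.take_length] at this
    omega
  -- A repetition or a chord would shorten the walk.
  have hinduced : ∀ i j, i < j → j ≤ p.length → p.getVert i ≠ p.getVert j ∧
      (G.Adj (p.getVert i) (p.getVert j) ↔ j = i + 1) := by
    intro i j hij hj
    have htake : ∀ z ∈ (p.take i).support, z ∈ C := fun z hz =>
      hpC z ((p.isSubwalk_take i).support_subset hz)
    have hdrop : ∀ z ∈ (p.drop j).support, z ∈ C := fun z hz =>
      hpC z ((p.isSubwalk_drop j).support_subset hz)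
    refine ⟨fun heq => ?_, fun hadj => ?_, fun h => ?_⟩
    · have := hshort _ ((p.take i).append ((p.drop j).copy heq.symm rfl)) (by
        intro z hz
        rw [Walk.mem_support_append_iff, Walk.support_copy] at hz
        exact hz.elim (htake z) (hdrop z)) hsy
      rw [Walk.length_append, Walk.length_copy, Walk.take_length, Walk.drop_length] at this
      omega
    · have := hshort _ ((p.take i).append (Walk.cons hadj (p.drop j))) (by
        intro z hz
        rw [Walk.mem_support_append_iff, Walk.support_cons, List.mem_cons] at hz
        rcases hz with hz | rfl | hz
        · exact htake z hz
        · exact hgC i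
        · exact hdrop z hz) hsy
      rw [Walk.length_append, Walk.length_cons, Walk.take_length, Walk.drop_length] at this
      omega
    · subst h
      exact p.adj_getVert_succ (by omega)
  have hyC : y ∈ C := hpC _ p.end_mem_support
  -- Otherwise `y` would have all the clique neighbors of `c` and also `s`, against the choice of
  -- `c`.
  obtain ⟨t, htQ, htc, hty⟩ : ∃ t ∈ Q, G.Adj t c ∧ ¬ G.Adj t y := by
    by_contra! hsub
    have hss : {s ∈ Q | G.Adj s c} ⊂ {s ∈ Q | G.Adj s y} :=
      ⟨fun t ht => ⟨ht.1, hsub t ht.1 ht.2⟩, fun h => hsc (h ⟨hs, hsy⟩).2⟩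
    have := Set.ncard_lt_ncard hss (Set.toFinite _)
    exact absurd (hmax hyC this.le) (not_le.mpr this)
  have hst : G.Adj s t := hQ hs htQ fun h => hsc (h ▸ htc)
  -- the last vertex of the walk that is adjacent to `t`
  let A : Finset ℕ := (Finset.range (p.length + 1)).filter fun i => G.Adj (p.getVert i) t
  have hA : A.Nonempty := ⟨0, by simp [A, htc.symm]⟩
  obtain ⟨i, hi, himax⟩ := A.exists_max_image id hA
  obtain ⟨hile, hit⟩ : i < p.length + 1 ∧ G.Adj (p.getVert i) t := by simpa [A] using hi
  have hil : i < p.length := by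
    refine lt_of_le_of_ne (by omega) fun h => hty ?_
    rw [h, Walk.getVert_length] at hit
    exact hit.symm
  have hilast : ∀ j, i < j → j ≤ p.length → ¬ G.Adj (p.getVert j) t := by
    intro j hij hj h
    have : j ≤ i := himax j (by simp [A, h]; omega)
    omega
  -- The cycle consists of the `m` walk vertices from position `i` to the end, then `s` and `t`;
  -- since `i` is not the last position, `m ≥ 2` and the length is at least four.
  let m := p.length - i + 1
  refine hG.not_cycle (n := m + 2) (by omega)
    (fun k => if k < m then p.getVert (i + k) else if k = m then s else t) ?_
  intro a b hab hb
  have hCQ : ∀ k, ∀ q ∈ Q, p.getVert k ≠ q := fun k q hq h => hdisj _ (hgC k) (h ▸ hq)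
  by_cases hbm : b < m
  · have ham : a < m := hab.trans hbm
    simp only [ham, hbm, if_true]
    have := hinduced (i + a) (i + b) (by omega) (by omega)
    refine ⟨this.1, this.2.trans ?_⟩
    omega
  · by_cases ham : a < m
    · simp only [ham, hbm, if_true, if_false]
      by_cases hbm' : b = m
      · simp only [hbm', if_true]
        refine ⟨hCQ _ s hs, fun h => ?_, fun h => ?_⟩
        · have := hs_only (i + a) (by omega) h
          omega
        · have : i + a = p.length := by omega
          rw [this, Walk.getVert_length]
          exact hsy.symm
      · simp only [hbm', if_false]
        refine ⟨hCQ _ t htQ, fun h => ?_, fun h => ?_⟩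
        · right
          refine ⟨?_, by omega⟩
          by_contra ha
          exact hilast (i + a) (by omega) (by omega) h
        · have : a = 0 := by omega
          rw [this]
          exact hit
    · have ham' : a = m := by omega
      have hbm' : b = m + 1 := by omega
      subst ham' hbm'
      simp only [lt_irrefl, if_false, if_true, Nat.succ_ne_self, Nat.not_succ_lt_self]
      refine ⟨?_, ?_⟩
      · simpa using hst.ne
      · simpa using hst

end Chordal

/-! ### Joining two trees by an edge. -/

section Glue

variable {W W' : Type u} {T : SimpleGraph W} {T' : SimpleGraph W'}

/-- `s` is the vertex set of a path from `x` to `y`. -/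
def PathBetween (T : SimpleGraph W) (x y : W) (s : Set W) : Prop :=
  ∃ p : T.Walk x y, p.IsPath ∧ s = {w | w ∈ p.support}

theorem PathBetween.isPathVertexSet {x y : W} {s : Set W} (h : PathBetween T x y s) :
    IsPathVertexSet T s :=
  ⟨x, y, h⟩

theorem PathBetween.singleton (T : SimpleGraph W) (x : W) : PathBetween T x x {x} :=
  ⟨Walk.nil, Walk.IsPath.nil, by ext; simp⟩

theorem PathBetween.symm {x y : W} {s : Set W} (h : PathBetween T x y s) : PathBetween T y x s := by
  obtain ⟨p, hp, rfl⟩ := h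
  exact ⟨p.reverse, hp.reverse, by ext; simp⟩

theorem PathBetween.append {x y z : W} {s s' : Set W} (h : PathBetween T x y s)
    (h' : PathBetween T y z s') (hss : ∀ w ∈ s, w ∈ s' → w = y) : PathBetween T x z (s ∪ s') := by
  obtain ⟨p, hp, rfl⟩ := h
  obtain ⟨q, hq, rfl⟩ := h'
  refine ⟨p.append q, isPath_append hp hq hss, ?_⟩
  ext w
  exact (Walk.mem_support_append_iff ..).symm

theorem PathBetween.map {x y : W} {s : Set W} (h : PathBetween T x y s) (f : T →g T')
    (hf : Function.Injective f) : PathBetween T' (f x) (f y) (f '' s) := by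
  obtain ⟨p, hp, rfl⟩ := h
  refine ⟨p.map f, Walk.IsPath.map hf hp, ?_⟩
  ext w
  simp

/-- Two graphs joined by a single edge. -/
def glue (T : SimpleGraph W) (T' : SimpleGraph W') (x : W) (y : W') : SimpleGraph (W ⊕ W') :=
  (T ⊕g T') ⊔ edge (Sum.inl x) (Sum.inr y)

/-- The inclusion of the first graph. -/
def glueInl (T : SimpleGraph W) (T' : SimpleGraph W') (x : W) (y : W') : T →g glue T T' x y where
  toFun := Sum.inl
  map_rel' h := Or.inl (by simpa using h)

/-- The inclusion of the second graph. -/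
def glueInr (T : SimpleGraph W) (T' : SimpleGraph W') (x : W) (y : W') : T' →g glue T T' x y where
  toFun := Sum.inr
  map_rel' h := Or.inl (by simpa using h)

theorem glue_adj (x : W) (y : W') : (glue T T' x y).Adj (Sum.inl x) (Sum.inr y) :=
  Or.inr (by simp [edge_adj])

theorem not_reachable_sum (x : W) (y : W') : ¬ (T ⊕g T').Reachable (Sum.inl x) (Sum.inr y) := by
  rintro ⟨p⟩
  obtain ⟨⟨⟨a, b⟩, hab⟩, -, ⟨a, rfl⟩, hb⟩ := p.exists_boundary_dart (Set.range Sum.inl) ⟨x, rfl⟩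
    (by simp)
  rcases b with b | b
  · exact hb ⟨b, rfl⟩
  · simp at hab

/-- The image is closed under adjacency, so a walk starting in it never leaves and can be lifted
edge by edge. Cycles in a disjoint sum are thereby pulled back to one summand. -/
theorem exists_walk_map_eq (f : T ↪g T') (hf : ∀ a z, T'.Adj (f a) z → z ∈ Set.range f) {x z : W'}
    (p : T'.Walk x z) : ∀ a (ha : f a = x), ∃ (b : W) (hb : f b = z) (q : T.Walk a b),
      (q.map f.toHom).copy ha hb = p := by
  induction p with
  | nil =>
    rintro a rfl
    exact ⟨a, rfl, Walk.nil, rfl⟩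
  | @cons x y z e p ih =>
    rintro a rfl
    obtain ⟨c, rfl⟩ := hf a y e
    obtain ⟨b, rfl, q, rfl⟩ := ih c rfl
    exact ⟨b, rfl, Walk.cons (f.map_adj_iff.mp e) q, rfl⟩

theorem not_isCycle_of_embedding (hT : T.IsAcyclic) (f : T ↪g T')
    (hf : ∀ a z, T'.Adj (f a) z → z ∈ Set.range f) (a : W) (p : T'.Walk (f a) (f a)) :
    ¬ p.IsCycle := by
  obtain ⟨b, hb, q, rfl⟩ := exists_walk_map_eq f hf p a rfl
  obtain rfl := f.injective hb
  intro h
  exact hT q ((Walk.isCycle_map_iff_of_injective f.injective).mp h)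

theorem isAcyclic_sum (hT : T.IsAcyclic) (hT' : T'.IsAcyclic) : (T ⊕g T').IsAcyclic := by
  rintro (v | v) p
  · refine not_isCycle_of_embedding hT Embedding.sumInl ?_ v p
    rintro a (z | z) h
    · exact ⟨z, rfl⟩
    · simp at h
  · refine not_isCycle_of_embedding hT' Embedding.sumInr ?_ v p
    rintro a (z | z) h
    · simp at h
    · exact ⟨z, rfl⟩

theorem glue_isTree (hT : T.IsTree) (hT' : T'.IsTree) (x : W) (y : W') :
    (glue T T' x y).IsTree := by
  refine ⟨?_, (isAcyclic_sum hT.2 hT'.2).sup_edge_of_not_reachable (not_reachable_sum x y)⟩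
  have h : ∀ z, (glue T T' x y).Reachable (Sum.inl x) z := by
    rintro (z | z)
    · exact (hT.1.preconnected x z).map (glueInl T T' x y)
    · exact (glue_adj x y).reachable.trans ((hT'.1.preconnected y z).map (glueInr T T' x y))
  have : Nonempty (W ⊕ W') := ⟨Sum.inl x⟩
  exact ⟨fun a b => (h a).symm.trans (h b)⟩

theorem PathBetween.inl {a b : W} {s : Set W} (h : PathBetween T a b s) (x : W) (y : W') :
    PathBetween (glue T T' x y) (Sum.inl a) (Sum.inl b) (Sum.inl '' s) :=
  h.map (glueInl T T' x y) Sum.inl_injective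

theorem PathBetween.inr {a b : W'} {s : Set W'} (h : PathBetween T' a b s) (x : W) (y : W') :
    PathBetween (glue T T' x y) (Sum.inr a) (Sum.inr b) (Sum.inr '' s) :=
  h.map (glueInr T T' x y) Sum.inr_injective

theorem PathBetween.glue {a x : W} {y b : W'} {s : Set W} {s' : Set W'}
    (h : PathBetween T a x s) (h' : PathBetween T' y b s') :
    PathBetween (glue T T' x y) (Sum.inl a) (Sum.inr b) (Sum.inl '' s ∪ Sum.inr '' s') := by
  have he : PathBetween (PathGraph.glue T T' x y) (Sum.inl x) (Sum.inr y)
      ({Sum.inl x, Sum.inr y}) := by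
    refine ⟨Walk.cons (glue_adj x y) Walk.nil, by simp, ?_⟩
    ext w
    simp
  have hx : x ∈ s := by
    obtain ⟨p, -, rfl⟩ := h
    exact p.end_mem_support
  have hy : y ∈ s' := by
    obtain ⟨p, -, rfl⟩ := h'
    exact p.start_mem_support
  have := ((h.inl x y).append he (by rintro _ ⟨z, -, rfl⟩ hz; simpa using hz)).append
    (h'.inr x y) (by
      rintro (w | w) hw hw'
      · simp at hw'
      · simpa using hw)
  convert this using 1
  ext (w | w)
  · simp only [Set.mem_union, Set.mem_image, Sum.inl.injEq, exists_eq_right, reduceCtorEq,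
      and_false, exists_false, or_false, Set.mem_insert_iff, Set.mem_singleton_iff]
    exact ⟨Or.inl, fun h => h.elim id fun h => h ▸ hx⟩
  · simp only [Set.mem_union, Set.mem_image, Sum.inr.injEq, exists_eq_right, reduceCtorEq,
      and_false, exists_false, false_or, Set.mem_insert_iff, Set.mem_singleton_iff]
    exact ⟨Or.inr, fun h => h.elim (fun h => h ▸ hy) id⟩

end Glue

/-! ### Building the clique tree. -/

section Decomposition

variable {V : Type u} {G : SimpleGraph V} {Q : Set V}

theorem exists_maximal_isClique [Finite V] {S : Set V} (hS : G.IsClique S) :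
    ∃ K, S ⊆ K ∧ Maximal G.IsClique K :=
  (Set.toFinite {K : Set V | G.IsClique K}).exists_le_maximal hS

theorem SepPart.connIn_supp (γ : SepPart G Q) : ConnIn G γ.comp.supp := by
  have key : ∀ {u v : ↥Qᶜ} (_ : (G.induce Qᶜ).Walk u v), (u : V) ∈ γ.comp.supp →
      ∃ p : G.Walk u v, ∀ z ∈ p.support, z ∈ γ.comp.supp := by
    intro u v p
    induction p with
    | nil => exact fun hu => ⟨Walk.nil, by simpa using hu⟩
    | @cons u w v e p ih =>
      intro hu
      obtain ⟨p', hp'⟩ := ih (ComponentCompl.mem_of_adj _ _ hu w.2 e)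
      have e' : G.Adj (u : V) (w : V) := e
      refine ⟨Walk.cons e' p', fun z hz => ?_⟩
      rw [Walk.support_cons, List.mem_cons] at hz
      rcases hz with rfl | hz
      · exact hu
      · exact hp' z hz
  intro u hu v hv
  have : (G.induce Qᶜ).Reachable ⟨u, hu.choose⟩ ⟨v, hv.choose⟩ :=
    ConnectedComponent.exact (hu.choose_spec.trans hv.choose_spec.symm)
  obtain ⟨p⟩ := this
  exact key p hu

/-- The part containing a vertex outside `Q`. -/
def SepPart.of (G : SimpleGraph V) {Q : Set V} {v : V} (hv : v ∉ Q) : SepPart G Q :=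
  ⟨G.componentComplMk hv⟩

theorem SepPart.mem_of {v : V} (hv : v ∉ Q) : v ∈ (SepPart.of G hv).comp.supp :=
  componentComplMk_mem G hv

/-- `B` can be a bag of a tree for `γ`. -/
structure SepPart.IsBag (γ : SepPart G Q) (B : Set V) : Prop where
  maximal : Maximal G.IsClique B
  subset : B ⊆ γ.comp.supp ∪ Q
  meets : (B ∩ γ.comp.supp).Nonempty

theorem SepPart.IsBag.relevant {γ : SepPart G Q} {B : Set V} (hB : γ.IsBag B)
    (h : (B ∩ Q).Nonempty) : γ.Relevant B := by
  refine ⟨⟨⟨hB.subset, hB.maximal.1⟩, fun S hS hBS => hB.maximal.2 hS.2 hBS⟩, h, ?_⟩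
  rintro rfl
  obtain ⟨c, hc, hc'⟩ := hB.meets
  exact SepPart.notMem_of_mem_supp hc' hc

theorem SepPart.IsBag.neighborOf {γ : SepPart G Q} {B : Set V} (hB : γ.IsBag B) {v : V}
    (hvB : v ∈ B) (hv : v ∈ Q) : γ.NeighborOf v :=
  ⟨B, hB.relevant ⟨v, hvB, hv⟩, hvB⟩

theorem SepPart.isBag_of_mem {γ : SepPart G Q} {B : Set V} (hB : Maximal G.IsClique B) {c : V}
    (hcB : c ∈ B) (hc : c ∈ γ.comp.supp) : γ.IsBag B := by
  refine ⟨hB, fun x hx => ?_, c, hcB, hc⟩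
  by_cases h : c = x
  · exact Or.inl (h ▸ hc)
  · exact SepPart.adj_mem_verts hc (hB.1 hcB hx h)

theorem SepPart.neighborOf_of_adj [Finite V] {γ : SepPart G Q} {v c : V} (hv : v ∈ Q)
    (hc : c ∈ γ.comp.supp) (h : G.Adj v c) : γ.NeighborOf v := by
  obtain ⟨K, hK, hKmax⟩ := exists_maximal_isClique (G := G) (S := {v, c})
    (isClique_pair.mpr fun _ => h)
  exact (SepPart.isBag_of_mem hKmax (hK (by simp)) hc).neighborOf (hK (by simp)) hv

/-- A bag of a part that dominates `γ`, or is not attached to `γ`, contains all the vertices of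
`Q` seen by `γ` or none of them. -/
theorem SepPart.IsBag.subset_or_disjoint {γ γ' : SepPart G Q} {B S : Set V} (hB : γ'.IsBag B)
    (hne : γ ≠ γ') (h : γ.Attached γ' → γ ≤ γ') (hSQ : S ⊆ Q) (hS : ∀ v ∈ S, γ.NeighborOf v) :
    S ⊆ B ∨ Disjoint S B := by
  by_cases hSB : Disjoint S B
  · exact Or.inr hSB
  obtain ⟨v, hvS, hvB⟩ := Set.not_disjoint_iff.mp hSB
  have hvQ := hSQ hvS
  have hatt : γ.Attached γ' :=
    SepPart.attached_iff.mpr ⟨v, hvQ, hS v hvS, hB.neighborOf hvB hvQ⟩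
  obtain ⟨-, hdom⟩ := (h hatt).resolve_left hne
  rcases hdom B (hB.relevant ⟨v, hvB, hvQ⟩) with hd | hd
  · left
    intro w hw
    obtain ⟨K, hK, hwK⟩ := hS w hw
    exact (hd K hK ⟨hwK, hSQ hw⟩).1
  · obtain ⟨K, hK, hvK⟩ := hS v hvS
    exact absurd ⟨v, ⟨hvK, hvB⟩, hvQ⟩ (Set.not_nonempty_iff_eq_empty.mpr (hd K hK))

/-- A clique path tree for the part `γ`, with `Q` removed: the paths of the vertices of `Q` start
at the root. -/
structure PieceTree (γ : SepPart G Q) : Type (u + 1) where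
  W : Type u
  finite : Finite W
  T : SimpleGraph W
  isTree : T.IsTree
  root : W
  bag : W → Set V
  isBag : ∀ z, γ.IsBag (bag z)
  path : ∀ v ∈ γ.comp.supp, IsPathVertexSet T {z | v ∈ bag z}
  rooted : ∀ v ∈ Q, γ.NeighborOf v → ∃ e, PathBetween T root e {z | v ∈ bag z}
  cover : ∀ v ∈ γ.comp.supp, ∀ w, G.Adj v w → ∃ z, v ∈ bag z ∧ w ∈ bag z

/-- A clique tree for `Q` and the parts in `J`, in which for every vertex of `Q` and every color
the bags of the parts of this color form a path starting at `Q`. -/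
structure GluedTree {α : Type u} (f : SepPart G Q → α) (J : Set (SepPart G Q)) :
    Type (u + 1) where
  W : Type u
  finite : Finite W
  T : SimpleGraph W
  isTree : T.IsTree
  center : W
  bag : W → Set V
  part : W → Option (SepPart G Q)
  part_eq_none : ∀ z, part z = none → z = center
  part_center : part center = none
  bag_center : bag center = Q
  part_mem : ∀ z γ, part z = some γ → γ ∈ J
  isBag : ∀ z γ, part z = some γ → γ.IsBag (bag z)
  path : ∀ γ ∈ J, ∀ v ∈ γ.comp.supp, IsPathVertexSet T {z | v ∈ bag z}
  -- The center is always included, so that an unused color still gives a path, the trivial one, and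
  -- arms of two colors meet exactly there.
  branch : ∀ v ∈ Q, ∀ a, ∃ e, PathBetween T center e
    {z | z = center ∨ ∃ γ, part z = some γ ∧ f γ = a ∧ v ∈ bag z}
  cover : ∀ γ ∈ J, ∀ v ∈ γ.comp.supp, ∀ w, G.Adj v w → ∃ z, v ∈ bag z ∧ w ∈ bag z

namespace GluedTree

variable {α : Type u} {f : SepPart G Q → α} {J : Set (SepPart G Q)}

/-- The tree whose only node is `Q`. -/
def empty (f : SepPart G Q → α) : GluedTree f ∅ where
  W := PUnit
  finite := inferInstance
  T := ⊥
  isTree := IsTree.of_subsingleton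
  center := PUnit.unit
  bag := fun _ => Q
  part := fun _ => none
  part_eq_none := fun _ _ => rfl
  part_center := rfl
  bag_center := rfl
  part_mem := by simp
  isBag := by simp
  path := by simp
  branch := fun v _ a => ⟨PUnit.unit, by
    convert PathBetween.singleton _ _
    ext
    simp⟩
  cover := by simp

/-- If every bag of color `a` contains `S` or is disjoint from `S`, then the paths of color `a` of
the vertices of `S` have a common end. -/
theorem exists_common_end (R : GluedTree f J) {S : Set V} (hS : S ⊆ Q) {a : α}
    (h : ∀ z γ, R.part z = some γ → f γ = a → S ⊆ R.bag z ∨ Disjoint S (R.bag z)) :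
    ∃ e, ∀ v ∈ S, PathBetween R.T R.center e
      {z | z = R.center ∨ ∃ γ, R.part z = some γ ∧ f γ = a ∧ v ∈ R.bag z} := by
  rcases S.eq_empty_or_nonempty with rfl | ⟨v₀, hv₀⟩
  · exact ⟨R.center, by simp⟩
  obtain ⟨e, he⟩ := R.branch v₀ (hS hv₀) a
  refine ⟨e, fun v hv => ?_⟩
  convert he using 1
  have key : ∀ u ∈ S, ∀ w ∈ S, ∀ z γ, R.part z = some γ → f γ = a → u ∈ R.bag z →
      w ∈ R.bag z := by
    intro u hu w hw z γ hz hγ huz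
    rcases h z γ hz hγ with h | h
    · exact h hw
    · exact absurd huz (Set.disjoint_left.mp h hu)
  ext z
  refine or_congr_right (exists_congr fun γ => ?_)
  exact ⟨fun ⟨h1, h2, h3⟩ => ⟨h1, h2, key v hv v₀ hv₀ z γ h1 h2 h3⟩,
    fun ⟨h1, h2, h3⟩ => ⟨h1, h2, key v₀ hv₀ v hv z γ h1 h2 h3⟩⟩

theorem bag_subset (R : GluedTree f J) (z : R.W) {v : V} (hv : v ∈ R.bag z) :
    v ∈ Q ∨ ∃ γ ∈ J, v ∈ γ.comp.supp := by
  rcases hz : R.part z with _ | γ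
  · rw [R.part_eq_none z hz, R.bag_center] at hv
    exact Or.inl hv
  · exact ((R.isBag z γ hz).subset hv).symm.imp_right fun h => ⟨γ, R.part_mem z γ hz, h⟩

theorem isClique_bag (R : GluedTree f J) (hQ : G.IsClique Q) (z : R.W) :
    G.IsClique (R.bag z) := by
  rcases hz : R.part z with _ | γ
  · rwa [R.part_eq_none z hz, R.bag_center]
  · exact (R.isBag z γ hz).maximal.1

/-- Hanging the tree of a further part at a node. -/
theorem attach (R : GluedTree f J) {γ : SepPart G Q} (hγ : γ ∉ J)
    (P : PieceTree γ) (x : R.W) (hx : ∀ v ∈ Q, γ.NeighborOf v → PathBetween R.T R.center x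
      {z | z = R.center ∨ ∃ γ', R.part z = some γ' ∧ f γ' = f γ ∧ v ∈ R.bag z}) :
    Nonempty (GluedTree f (insert γ J)) := by
  have := R.finite
  have := P.finite
  have hset : ∀ v, {z | v ∈ Sum.elim R.bag P.bag z} =
      Sum.inl '' {z | v ∈ R.bag z} ∪ Sum.inr '' {z | v ∈ P.bag z} := by
    intro v
    ext (z | z) <;> simp
  refine ⟨{
    W := R.W ⊕ P.W
    finite := inferInstance
    T := glue R.T P.T x P.root
    isTree := glue_isTree R.isTree P.isTree x P.root
    center := Sum.inl R.center
    bag := Sum.elim R.bag P.bag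
    part := Sum.elim R.part fun _ => some γ
    part_eq_none := ?_
    part_center := R.part_center
    bag_center := R.bag_center
    part_mem := ?_
    isBag := ?_
    path := ?_
    branch := ?_
    cover := ?_ }⟩
  · rintro (z | z) h
    · exact congrArg Sum.inl (R.part_eq_none z h)
    · simp at h
  · rintro (z | z) γ' h
    · exact Or.inr (R.part_mem z γ' h)
    · exact Or.inl (by simpa using h.symm)
  · rintro (z | z) γ' h
    · exact R.isBag z γ' h
    · obtain rfl : γ = γ' := by simpa using h
      exact P.isBag z
  · rintro γ' (rfl | hγ') v hv
    · have h1 : {z | v ∈ R.bag z} = ∅ := by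
        refine Set.eq_empty_iff_forall_notMem.mpr fun z hz => ?_
        rcases R.bag_subset z hz with h | ⟨γ'', h1, h2⟩
        · exact SepPart.notMem_of_mem_supp hv h
        · exact hγ (SepPart.eq_of_mem_supp hv h2 ▸ h1)
      obtain ⟨a, b, h⟩ := P.path v hv
      rw [hset, h1, Set.image_empty, Set.empty_union]
      exact (PathBetween.inr h x P.root).isPathVertexSet
    · have h1 : {z | v ∈ P.bag z} = ∅ := by
        refine Set.eq_empty_iff_forall_notMem.mpr fun z hz => ?_
        rcases (P.isBag z).subset hz with h | h
        · exact hγ (SepPart.eq_of_mem_supp h hv ▸ hγ')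
        · exact SepPart.notMem_of_mem_supp hv h
      obtain ⟨a, b, h⟩ := R.path γ' hγ' v hv
      rw [hset, h1, Set.image_empty, Set.union_empty]
      exact (PathBetween.inl h x P.root).isPathVertexSet
  · intro v hv a
    have hset' : {z | z = Sum.inl R.center ∨ ∃ γ', Sum.elim R.part (fun _ => some γ) z = some γ' ∧
          f γ' = a ∧ v ∈ Sum.elim R.bag P.bag z} =
        Sum.inl '' {z | z = R.center ∨ ∃ γ', R.part z = some γ' ∧ f γ' = a ∧ v ∈ R.bag z} ∪
          Sum.inr '' {z | f γ = a ∧ v ∈ P.bag z} := by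
      ext (z | z) <;> simp
    rw [hset']
    -- Only in this case does the arm grow: it ends at `x`, and the rooted path of `v` in the new
    -- tree continues it across the new edge.
    by_cases h : f γ = a ∧ γ.NeighborOf v
    · obtain ⟨rfl, hvγ⟩ := h
      obtain ⟨e, he⟩ := P.rooted v hv hvγ
      exact ⟨Sum.inr e, by simpa using (hx v hv hvγ).glue he⟩
    · have h1 : {z | f γ = a ∧ v ∈ P.bag z} = ∅ :=
        Set.eq_empty_iff_forall_notMem.mpr fun z hz =>
          h ⟨hz.1, (P.isBag z).neighborOf hz.2 hv⟩
      obtain ⟨e, he⟩ := R.branch v hv a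
      rw [h1, Set.image_empty, Set.union_empty]
      exact ⟨Sum.inl e, he.inl x P.root⟩
  · rintro γ' (rfl | hγ') v hv w hvw
    · obtain ⟨z, hz⟩ := P.cover v hv w hvw
      exact ⟨Sum.inr z, hz⟩
    · obtain ⟨z, hz⟩ := R.cover γ' hγ' v hv w hvw
      exact ⟨Sum.inl z, hz⟩

/-- A minimal part `γ` of `J` is hung on last. Every attached part of its color already present
dominates it, so each bag of that color contains all or none of the vertices of `Q` seen by `γ`; the
arms of these vertices therefore have a common end at which to hang the new tree. -/
theorem exists_of_pieces [Finite V]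
    (hf : ∀ a b : SepPart G Q, a.Attached b → f a = f b → a ≤ b ∨ b ≤ a)
    (J : Set (SepPart G Q)) (hJ : ∀ γ ∈ J, Nonempty (PieceTree γ)) :
    Nonempty (GluedTree f J) := by
  induction hn : J.ncard generalizing J with
  | zero =>
    obtain rfl := (Set.ncard_eq_zero (Set.toFinite J)).mp hn
    exact ⟨empty f⟩
  | succ n ih =>
    have hne : J.Nonempty := (Set.ncard_pos (Set.toFinite J)).mp (by omega)
    obtain ⟨γ, hγ⟩ := (Set.toFinite J).exists_minimal hne
    obtain ⟨R⟩ := ih (J \ {γ}) (fun γ' h => hJ γ' h.1)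
      (by rw [Set.ncard_sdiff_singleton_of_mem hγ.1, hn]; rfl)
    obtain ⟨P⟩ := hJ γ hγ.1
    obtain ⟨x, hx⟩ := R.exists_common_end (S := {v ∈ Q | γ.NeighborOf v}) (a := f γ)
      (fun v hv => hv.1) (by
        intro z γ' hz hff
        have hγ' := R.part_mem z γ' hz
        refine (R.isBag z γ' hz).subset_or_disjoint (fun h => hγ'.2 h.symm) (fun hatt => ?_)
          (fun v hv => hv.1) fun v hv => hv.2
        rcases hf γ γ' hatt hff.symm with h | h
        · exact h
        · exact hγ.2 hγ'.1 h)
    have := R.attach (by simp) P x fun v hv hvγ => hx v ⟨hv, hvγ⟩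
    rwa [Set.insert_sdiff_singleton, Set.insert_eq_of_mem hγ.1] at this

/-- If a vertex of `Q` sees only two colors, then its bags form a path. -/
theorem exists_pathBetween (R : GluedTree f J) {v : V} (hv : v ∈ Q) {a c : α}
    (h : ∀ γ ∈ J, γ.NeighborOf v → f γ = a ∨ f γ = c) {e : R.W}
    (he : PathBetween R.T R.center e
      {z | z = R.center ∨ ∃ γ, R.part z = some γ ∧ f γ = a ∧ v ∈ R.bag z}) :
    ∃ e', PathBetween R.T e e' {z | v ∈ R.bag z} := by
  have hcol : ∀ z, v ∈ R.bag z ↔ z = R.center ∨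
      ∃ γ, R.part z = some γ ∧ (f γ = a ∨ f γ = c) ∧ v ∈ R.bag z := by
    intro z
    constructor
    · intro hz
      rcases hp : R.part z with _ | γ
      · exact Or.inl (R.part_eq_none z hp)
      · exact Or.inr ⟨γ, rfl,
          h γ (R.part_mem z γ hp) ((R.isBag z γ hp).neighborOf hz hv), hz⟩
    · rintro (rfl | ⟨γ, -, -, hz⟩)
      · rw [R.bag_center]
        exact hv
      · exact hz
  by_cases hac : a = c
  · subst hac
    refine ⟨R.center, ?_⟩
    convert he.symm using 1
    ext z
    refine (hcol z).trans ?_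
    simp only [or_self]
    rfl
  · obtain ⟨e', he'⟩ := R.branch v hv c
    refine ⟨e', ?_⟩
    convert he.symm.append he' ?_ using 1
    · ext z
      refine (hcol z).trans ?_
      constructor
      · rintro (hz | ⟨γ, h1, h2 | h2, h3⟩)
        · exact Or.inl (Or.inl hz)
        · exact Or.inl (Or.inr ⟨γ, h1, h2, h3⟩)
        · exact Or.inr (Or.inr ⟨γ, h1, h2, h3⟩)
      · rintro ((hz | ⟨γ, h1, h2, h3⟩) | (hz | ⟨γ, h1, h2, h3⟩))
        · exact Or.inl hz
        · exact Or.inr ⟨γ, h1, Or.inl h2, h3⟩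
        · exact Or.inl hz
        · exact Or.inr ⟨γ, h1, Or.inr h2, h3⟩
    · rintro z (hz | ⟨γ, h1, h2, -⟩) (hz' | ⟨γ', h1', h2', -⟩)
      · exact hz
      · exact hz
      · exact hz'
      · rw [h1] at h1'
        obtain rfl : γ = γ' := by simpa using h1'
        exact absurd (h2.symm.trans h2') hac

theorem exists_two_colors (hf : ∀ v ∈ Q, ∀ a b c : SepPart G Q, a.NeighborOf v →
      b.NeighborOf v → c.NeighborOf v → f a = f b ∨ f a = f c ∨ f b = f c) {v : V} (hv : v ∈ Q)
    {γ₀ : SepPart G Q} (h₀ : γ₀.NeighborOf v) :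
    ∃ c, ∀ γ : SepPart G Q, γ.NeighborOf v → f γ = f γ₀ ∨ f γ = c := by
  by_cases h : ∃ γ₁ : SepPart G Q, γ₁.NeighborOf v ∧ f γ₁ ≠ f γ₀
  · obtain ⟨γ₁, h₁, hne⟩ := h
    refine ⟨f γ₁, fun γ hγ => ?_⟩
    rcases hf v hv γ γ₀ γ₁ hγ h₀ h₁ with h | h | h
    · exact Or.inl h
    · exact Or.inr h
    · exact absurd h.symm hne
  · push Not at h
    exact ⟨f γ₀, fun γ hγ => Or.inl (h γ hγ)⟩

theorem isPathVertexSet (R : GluedTree f J) (hf : ∀ v ∈ Q, ∀ a b c : SepPart G Q,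
      a.NeighborOf v → b.NeighborOf v → c.NeighborOf v → f a = f b ∨ f a = f c ∨ f b = f c)
    {v : V} (hv : v ∈ Q) : IsPathVertexSet R.T {z | v ∈ R.bag z} := by
  by_cases h : ∃ γ₀ : SepPart G Q, γ₀.NeighborOf v
  · obtain ⟨γ₀, h₀⟩ := h
    obtain ⟨c, hc⟩ := exists_two_colors hf hv h₀
    obtain ⟨e, he⟩ := R.branch v hv (f γ₀)
    obtain ⟨e', he'⟩ := R.exists_pathBetween hv (fun γ _ => hc γ) he
    exact he'.isPathVertexSet
  · have : {z | v ∈ R.bag z} = {R.center} := by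
      ext z
      refine ⟨fun hz => ?_, ?_⟩
      · rcases hp : R.part z with _ | γ
        · exact R.part_eq_none z hp
        · exact absurd ⟨γ, (R.isBag z γ hp).neighborOf hz hv⟩ h
      · rintro rfl
        simpa [R.bag_center] using hv
    rw [this]
    exact (PathBetween.singleton _ _).isPathVertexSet

end GluedTree

/-- The tree is built around a maximal clique `L` that contains `S` and a vertex `d` of the
component, from the components of `G - L` inside `C`. The rest of the graph enters as one more part
`C₀` of `L`, which is colored but not hung on. It sees all of `S`, and the place where its tree
would be hung is the root: there the arms of its color end for all vertices of `S`, so each of their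
paths starts at this node. -/
theorem exists_pieceTree [Finite V] (hG : IsChordal G)
    (hs : ∀ Q, Maximal G.IsClique Q → StrongColorable G Q) (n : ℕ) :
    ∀ K : Set V, Maximal G.IsClique K → ∀ C : SepPart G K, C.comp.supp.ncard = n →
      Nonempty (PieceTree C) := by
  induction n using Nat.strong_induction_on with
  | _ n ih =>
  intro K hK C hn
  -- a maximal clique of `C` containing every vertex of `K` seen by `C`
  let S : Set V := {v ∈ K | ∃ c ∈ C.comp.supp, G.Adj v c}
  obtain ⟨d, hd, hdS⟩ := hG.exists_adj_all C.connIn_supp C.supp_nonempty hK.1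
    fun c => SepPart.notMem_of_mem_supp
  obtain ⟨L, hSL, hL⟩ := exists_maximal_isClique (G := G) (S := insert d S)
    ((hK.1.subset fun v hv => hv.1).insert fun v hv _ => (hdS v hv.1 hv.2).symm)
  have hdL : d ∈ L := hSL (Set.mem_insert d S)
  have hSL : S ⊆ L := (Set.subset_insert d S).trans hSL
  have hLbag : C.IsBag L := SepPart.isBag_of_mem hL hdL hd
  have hadjC : ∀ c ∈ C.comp.supp, ∀ w, G.Adj c w → w ∈ C.comp.supp ∨ w ∈ S := by
    intro c hc w hcw
    exact (SepPart.adj_mem_verts hc hcw).imp_right fun hw => ⟨hw, c, hc, hcw.symm⟩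
  -- If `K ⊆ L`, maximality of `K` would put `d` in `K`.
  obtain ⟨k, hkK, hkL⟩ : ∃ k ∈ K, k ∉ L := by
    by_contra! h
    exact SepPart.notMem_of_mem_supp hd (hK.2 hL.1 h hdL)
  -- An edge leaving `C` ends in `S`, which is contained in `L` and so is not available in `G - L`.
  have hclosed : ∀ (γ : SepPart G L) u, u ∈ γ.comp.supp → u ∈ C.comp.supp →
      γ.comp.supp ⊆ C.comp.supp := by
    intro γ u hu huC w hw
    by_contra hwC
    obtain ⟨p, hp⟩ := γ.connIn_supp u hu w hw
    obtain ⟨e, he, h1, h2⟩ := p.exists_boundary_dart _ huC hwC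
    have h3 := hp _ (p.dart_snd_mem_support_of_mem_darts he)
    rcases hadjC _ h1 _ e.adj with h | h
    · exact h2 h
    · exact SepPart.notMem_of_mem_supp h3 (hSL h)
  obtain ⟨α, f, hf, hf2⟩ := hs L hL
  let J : Set (SepPart G L) := {γ | γ.comp.supp ⊆ C.comp.supp}
  have hJ : ∀ γ ∈ J, Nonempty (PieceTree γ) := by
    intro γ hγ
    refine ih _ ?_ L hL γ rfl
    rw [← hn]
    exact Set.ncard_lt_ncard ⟨hγ, fun h => SepPart.notMem_of_mem_supp (h hd) hdL⟩ (Set.toFinite _)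
  obtain ⟨R⟩ := GluedTree.exists_of_pieces hf J hJ
  let C₀ : SepPart G L := SepPart.of G hkL
  have hkC₀ : k ∈ C₀.comp.supp := SepPart.mem_of hkL
  have hC₀ : ∀ u ∈ C₀.comp.supp, u ∉ C.comp.supp := fun u hu huC =>
    SepPart.notMem_of_mem_supp (hclosed C₀ u hu huC hkC₀) hkK
  have hSC₀ : ∀ v ∈ S, C₀.NeighborOf v := by
    intro v hv
    exact SepPart.neighborOf_of_adj (hSL hv) hkC₀ (hK.1 hv.1 hkK fun h => hkL (h ▸ hSL hv))
  -- a part inside `C` sees a vertex of `C`, hence is not dominated by `C₀`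
  have hnot_le : ∀ γ ∈ J, ¬ γ ≤ C₀ := by
    intro γ hγ hle
    obtain ⟨c, hc⟩ := γ.supp_nonempty
    obtain ⟨p, hp⟩ := C.connIn_supp c (hγ hc) d hd
    obtain ⟨e, he, h1, h2⟩ := p.exists_boundary_dart _ hc
      fun h => SepPart.notMem_of_mem_supp h hdL
    have h3 := hp _ (p.dart_snd_mem_support_of_mem_darts he)
    have h4 := (SepPart.adj_mem_verts h1 e.adj).resolve_left h2
    have h5 := (SepPart.neighborOf_of_adj h4 h1 e.adj.symm).mono hle h4
    obtain ⟨c₀, h6, h7⟩ := h5.exists_adj hL.1 h4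
    rcases hadjC _ h3 _ h7 with h | h
    · exact hC₀ c₀ h6 h
    · exact SepPart.notMem_of_mem_supp h6 (hSL h)
  obtain ⟨x, hx⟩ := R.exists_common_end (a := f C₀) hSL (by
    intro z γ hz hff
    have hγ := R.part_mem z γ hz
    refine (R.isBag z γ hz).subset_or_disjoint (γ := C₀) ?_ (fun hatt => ?_) hSL hSC₀
    · rintro rfl
      exact hnot_le _ hγ le_rfl
    · exact (hf _ _ hatt hff.symm).resolve_right (hnot_le γ hγ))
  have hofJ : ∀ v ∈ C.comp.supp, ∀ h : v ∉ L, SepPart.of G h ∈ J := fun v hv h =>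
    hclosed _ v (SepPart.mem_of h) hv
  refine ⟨{
    W := R.W
    finite := R.finite
    T := R.T
    isTree := R.isTree
    root := x
    bag := R.bag
    isBag := ?_
    path := ?_
    rooted := ?_
    cover := ?_ }⟩
  · intro z
    rcases hz : R.part z with _ | γ
    · rwa [R.part_eq_none z hz, R.bag_center]
    · obtain ⟨h1, h2, c, hcB, hc⟩ := R.isBag z γ hz
      exact SepPart.isBag_of_mem h1 hcB (R.part_mem z γ hz hc)
  · intro v hv
    by_cases h : v ∈ L
    · exact R.isPathVertexSet hf2 h
    · exact R.path _ (hofJ v hv h) v (SepPart.mem_of h)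
  · intro v hv hvC
    -- As `v` sees `C₀`, the color of `C₀` is one of its at most two colors; its bags run from `x`
    -- to the center and on along the other arm.
    have hvS : v ∈ S := ⟨hv, hvC.exists_adj hK.1 hv⟩
    obtain ⟨c, hc⟩ := GluedTree.exists_two_colors hf2 (hSL hvS) (hSC₀ v hvS)
    exact R.exists_pathBetween (hSL hvS) (fun γ _ => hc γ) (hx v hvS)
  · intro v hv w hvw
    by_cases h : v ∈ L
    · by_cases h' : w ∈ L
      · exact ⟨R.center, by rw [R.bag_center]; exact ⟨h, h'⟩⟩
      · have hw : w ∈ C.comp.supp := (hadjC v hv w hvw).resolve_right fun hw => h' (hSL hw)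
        obtain ⟨z, h1, h2⟩ := R.cover _ (hofJ w hw h') w (SepPart.mem_of h') v hvw.symm
        exact ⟨z, h2, h1⟩
    · exact R.cover _ (hofJ v hv h) v (SepPart.mem_of h) w hvw

/-- Pendant nodes make the paths of a representation distinct. -/
theorem isPathGraph_of_paths [Finite V] {W : Type u} [Finite W] {T : SimpleGraph W}
    (hT : T.IsTree) {φ : V → Set W} (hφ : ∀ v, IsPathVertexSet T (φ v))
    (hadj : ∀ v w, v ≠ w → (G.Adj v w ↔ (φ v ∩ φ w).Nonempty)) : IsPathGraph G := by
  -- Induction on the set of vertices that already own a private node; the path of the next vertex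
  -- is extended at its end `y` by a new leaf.
  have key : ∀ A : Set V, A.Finite → ∃ (W : Type u) (_ : Finite W) (T : SimpleGraph W)
      (φ : V → Set W), T.IsTree ∧ (∀ v, IsPathVertexSet T (φ v)) ∧
        (∀ v w, v ≠ w → (G.Adj v w ↔ (φ v ∩ φ w).Nonempty)) ∧
        ∀ a ∈ A, ∃ z ∈ φ a, ∀ w, w ≠ a → z ∉ φ w := by
    intro A hA
    induction A, hA using Set.Finite.induction_on with
    | empty => exact ⟨W, inferInstance, T, φ, hT, hφ, hadj, by simp⟩
    | @insert a A _ _ ih =>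
      obtain ⟨W, hW, T, φ, hT, hφ, hadj, hA⟩ := ih
      obtain ⟨x, y, hxy⟩ := hφ a
      refine ⟨W ⊕ PUnit, inferInstance, glue T (⊥ : SimpleGraph PUnit) y PUnit.unit,
        fun v => Sum.inl '' φ v ∪ Sum.inr '' {_z | v = a},
        glue_isTree hT IsTree.of_subsingleton _ _, ?_, ?_, ?_⟩
      · intro v
        by_cases h : v = a
        · subst h
          convert (PathBetween.glue hxy (PathBetween.singleton (⊥ : SimpleGraph PUnit)
            PUnit.unit)).isPathVertexSet using 3
          ext
          simp
        · obtain ⟨x', y', h'⟩ := hφ v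
          convert (PathBetween.inl h' y PUnit.unit).isPathVertexSet using 1
          simp [h]
      · intro v w hvw
        rw [hadj v w hvw]
        constructor
        · rintro ⟨z, hz, hz'⟩
          exact ⟨Sum.inl z, by simpa using hz, by simpa using hz'⟩
        · rintro ⟨z | z, hz, hz'⟩
          · exact ⟨z, by simpa using hz, by simpa using hz'⟩
          · have h1 : v = a := by simpa using hz
            have h2 : w = a := by simpa using hz'
            exact absurd (h1.trans h2.symm) hvw
      · rintro b (rfl | hb)
        · exact ⟨Sum.inr PUnit.unit, by simp, fun w hw => by simpa using hw⟩
        · obtain ⟨z, hz, hz'⟩ := hA b hb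
          exact ⟨Sum.inl z, by simpa using hz, fun w hw => by simpa using hz' w hw⟩
  obtain ⟨W, hW, T, φ, hT, hφ, hadj, h⟩ := key Set.univ Set.finite_univ
  refine ⟨W, hW, T, φ, hT, hφ, fun v w hvw => ?_, hadj⟩
  by_contra hne
  obtain ⟨z, hz, hz'⟩ := h v (Set.mem_univ v)
  exact hz' w (Ne.symm hne) (hvw ▸ hz)

/-- Any maximal clique serves as center, with all its parts hung on; it need not separate the graph.
-/
theorem isPathGraph_of_strongColorable [Finite V] (hG : IsChordal G)
    (hs : ∀ Q, Maximal G.IsClique Q → StrongColorable G Q) : IsPathGraph G := by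
  obtain ⟨Q, -, hQ⟩ := exists_maximal_isClique (G := G) (S := ∅) isClique_empty
  obtain ⟨α, f, hf, hf2⟩ := hs Q hQ
  obtain ⟨R⟩ := GluedTree.exists_of_pieces hf Set.univ
    fun γ _ => exists_pieceTree hG hs _ Q hQ γ rfl
  have := R.finite
  refine isPathGraph_of_paths R.isTree (φ := fun v => {z | v ∈ R.bag z}) ?_ ?_
  · intro v
    by_cases h : v ∈ Q
    · exact R.isPathVertexSet hf2 h
    · exact R.path _ (Set.mem_univ _) v (SepPart.mem_of h)
  · intro v w hvw
    constructor
    · intro hadj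
      by_cases h : v ∈ Q
      · by_cases h' : w ∈ Q
        · exact ⟨R.center, by simpa [R.bag_center] using h, by simpa [R.bag_center] using h'⟩
        · obtain ⟨z, h1, h2⟩ := R.cover _ (Set.mem_univ _) w (SepPart.mem_of h') v hadj.symm
          exact ⟨z, h2, h1⟩
      · exact R.cover _ (Set.mem_univ _) v (SepPart.mem_of h) w hadj
    · rintro ⟨z, h1, h2⟩
      exact R.isClique_bag hQ.1 z h1 h2 hvw

/-- This covers the maximal cliques that are not separators, about which the weak coloring
hypothesis says nothing. -/
theorem strongColorable_of_subsingleton [Subsingleton (G.ComponentCompl Q)] :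
    StrongColorable G Q :=
  ⟨PUnit, fun _ => PUnit.unit,
    fun a b _ _ => Or.inl (SepPart.ext (Subsingleton.elim a.comp b.comp)).le,
    fun _ _ _ _ _ _ _ _ => Or.inl rfl⟩

end Decomposition

end PathGraph

theorem theorem3p6 {V : Type u} [Finite V] (G : SimpleGraph V) (hG : PathGraph.IsChordal G)
    (o : ∀ Q : Set V, PathGraph.UpperOrdering G Q) :
    PathGraph.IsPathGraph G ↔
      ∀ Q : Set V, PathGraph.IsCliqueSeparator G Q →
        (¬ ∃ a ∈ PathGraph.Upper G Q, ∃ b ∈ PathGraph.Upper G Q, ∃ c ∈ PathGraph.Upper G Q,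
          PathGraph.IsFullAntipodalTriple a b c) ∧
        ∃ f : PathGraph.Gam G Q → Fin (PathGraph.ell G Q + 1),
          PathGraph.IsWeakColoring (o Q) f := by
  constructor
  · exact fun h Q hQ => (h.strongColorable hQ.1).weak (o Q)
  · intro h
    refine PathGraph.isPathGraph_of_strongColorable hG fun Q hQ => ?_
    rcases subsingleton_or_nontrivial (G.ComponentCompl Q) with hc | hc
    · exact PathGraph.strongColorable_of_subsingleton
    · obtain ⟨hT, f, hf⟩ := h Q ⟨hQ, hc⟩
      exact PathGraph.strongColorable_of_weak hT hf
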